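/- Conventions. A graph $G$ is finite, given by vertices $V(G)$, half-edges $H(G)$, a root map $r:H(G)\to V(G)$ and a fixed-point-free involution of $H(G)$, whose orbits are the edges $E(G)$ (loops and multiple edges are allowed). A double cover $\pi:\widetilde\Gamma\to\Gamma$ of metric graphs is given by a model: a harmonic morphism $p:\widetilde G\to G$ of global degree two between connected finite graphs, with local degrees $d_p>0$, together with edge lengths $\widetilde\ell,\ell>0$ satisfying $\ell(p(\widetilde e))=d_p(\widetilde e)\,\widetilde\ell(\widetilde e)$. An edge $e$ of $G$ is dilated if an edge of local degree $2$ lies above it; $E_{\mathrm{ud}}(\Gamma)$ is the set of undilated edges, each of which has exactly two edges above it. The signed cographic matroid $M^*=M^*(\widetilde\Gamma/\Gamma)$ has ground set $E_{\mathrm{ud}}(\Gamma)$; a set $F$ is independent if the preimage in $\widetilde G\setminus p^{-1}(F)$ of every connected component of $G\setminus F$ is connected. For independent $F$, the index $\mathrm{ind}(F)$ is the number of connected components of $G\setminus F$. The signed graphic matroid $M$ is the dual of $M^*$. Choose an orientation of $G$, with the induced orientation of $\widetilde G$, and a labelling $\widetilde e^{+},\widetilde e^{-}$ of the two edges above each undilated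 edge $e$. Each element of $\ker(p_*:H_1(\widetilde G,\mathbb Z)\to H_1(G,\mathbb Z))$ can be written as $\gamma=\sum_{e\in E_{\mathrm{ud}}(\Gamma)}\gamma(e)(\widetilde e^{+}-\widetilde e^{-})$. For every circuit $C$ of $M$, the elements of $\ker p_*$ supported on $p^{-1}(C)$ form an infinite cyclic group; let $\gamma_C$ be a generator. The oriented matroid $\overrightarrow M$ is the one whose oriented circuits are the sign vectors $(\operatorname{sign}\gamma_C(e))_{e}$ of the two generators $\pm\gamma_C$, for all circuits $C$ of $M$. A reorientation of $\overrightarrow M$ is obtained by reversing all signs on a fixed subset of the ground set. An integral torus is a triple $(\Lambda,\Lambda',[\cdot,\cdot])$ of finitely generated free abelian groups with a pairing $\Lambda\times\Lambda'\to\mathbb R$ that is nondegenerate over $\mathbb R$. A polarization is a homomorphism $\xi:\Lambda'\to\Lambda$ such that $[\xi(\cdot),\cdot]$ is symmetric and positive definite on $\Lambda'_{\mathbb R}$; it is principal if it is bijective, and a pptav is an integral torus with a principal polarization. An isomorphism of pptavs $(\Lambda_1,\Lambda_1',\xi_1)\to(\Lambda_2,\Lambda_2',\xi_2)$ is a pair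 of isomorphisms $f^\#:\Lambda_2\to\Lambda_1$, $f_\#:\Lambda_1'\to\Lambda_2'$ with $[f^\#\lambda,\lambda']_1=[\lambda,f_\#\lambda']_2$ for all $\lambda\in\Lambda_2$, $\lambda'\in\Lambda_1'$, and $f^\#\xi_2f_\#=\xi_1$. The Jacobian of a metric graph is $(H_1,H_1,[\cdot,\cdot])$ with $[\gamma,\delta]=\sum_e\gamma(e)\delta(e)\ell(e)$ and principal polarization the identity. The Prym variety $\mathrm{Prym}(\widetilde\Gamma/\Gamma)=\big((\operatorname{coker}\pi^*)^{\mathrm{tf}},\ker\pi_*,[\cdot,\cdot]\big)$ is the kernel torus of the norm homomorphism $(\pi^*,\pi_*):\mathrm{Jac}(\widetilde\Gamma)\to\mathrm{Jac}(\Gamma)$, where $\mathrm{tf}$ denotes the quotient by torsion. It carries the polarization $\xi$ induced from $\mathrm{Jac}(\widetilde\Gamma)$, and its principalization $\mathrm{Prym}_p(\widetilde\Gamma/\Gamma)$ is the pptav $\big(\operatorname{im}\xi,\ker\pi_*,[\cdot,\cdot]\big)$ with principal polarization $\xi$. Corollary. Let $\pi_i:\widetilde\Gamma_i\to\Gamma_i$,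 $i=1,2$, be double covers of metric graphs, with orientations and labellings chosen. Let $M_i^*$, $\overrightarrow M_i$, $\mathrm{ind}_i$ and $\ell_i$ be the associated signed cographic matroids, oriented matroids, index functions, and edge lengths on $E_{\mathrm{ud}}(\Gamma_i)$. Suppose that there is a bijection $\varphi:E_{\mathrm{ud}}(\Gamma_1)\to E_{\mathrm{ud}}(\Gamma_2)$ such that 1. $\ell_2(\varphi(e))=\ell_1(e)$ for all $e$; 2. $F$ is independent in $M_1^*$ if and only if $\varphi(F)$ is independent in $M_2^*$, for all $F\subset E_{\mathrm{ud}}(\Gamma_1)$; 3. $\mathrm{ind}_2(\varphi(F))=\mathrm{ind}_1(F)$ for all independent sets $F$ of $M_1^*$; 4. $\varphi$ carries the oriented circuits of $\overrightarrow M_1$ bijectively to the oriented circuits of some reorientation of $\overrightarrow M_2$. Then $\mathrm{Prym}_p(\widetilde\Gamma_1/\Gamma_1)\cong\mathrm{Prym}_p(\widetilde\Gamma_2/\Gamma_2)$ as pptavs. -/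

import Mathlib

open scoped TensorProduct

noncomputable section

namespace TropicalPrym

universe u v w

/-! ### Tropical abelian varieties -/

/-- The real-bilinear extension `A_ℝ × B_ℝ → ℝ` of a biadditive pairing `A × B → ℝ`. -/
def realExtension {A B : Type*} [AddCommGroup A] [AddCommGroup B]
    (p : A →ₗ[ℤ] B →ₗ[ℤ] ℝ) : (ℝ ⊗[ℤ] A) →ₗ[ℝ] (ℝ ⊗[ℤ] B) →ₗ[ℝ] ℝ :=
  (((LinearMap.liftBaseChangeEquiv (R := ℤ) (M := B) (N := ℝ) ℝ).toLinearMap.restrictScalars ℤ)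
    ∘ₗ p).liftBaseChange ℝ

@[simp]
theorem realExtension_tmul {A B : Type*} [AddCommGroup A] [AddCommGroup B]
    (p : A →ₗ[ℤ] B →ₗ[ℤ] ℝ) (r s : ℝ) (a : A) (b : B) :
    realExtension p (r ⊗ₜ a) (s ⊗ₜ b) = r * (s * p a b) := by
  simp [realExtension]

/-- An integral torus `(Λ, Λ', [·,·])`: finitely generated free abelian groups and a pairing
`Λ × Λ' → ℝ` whose real extension is nondegenerate (so both groups have the same rank, and
`Λ'` is a full lattice in `Hom(Λ, ℝ)`). -/
structure IntegralTorus where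
  L : Type u
  L' : Type u
  [grpL : AddCommGroup L]
  [grpL' : AddCommGroup L']
  [freeL : Module.Free ℤ L]
  [freeL' : Module.Free ℤ L']
  [finL : Module.Finite ℤ L]
  [finL' : Module.Finite ℤ L']
  pairing : L →ₗ[ℤ] L' →ₗ[ℤ] ℝ
  nondegenerate : (realExtension pairing).Nondegenerate

attribute [instance] IntegralTorus.grpL IntegralTorus.grpL' IntegralTorus.freeL
  IntegralTorus.freeL' IntegralTorus.finL IntegralTorus.finL'

namespace IntegralTorus

/-- A homomorphism of integral tori `S → T` is a pair `(f^#, f_#)` of adjoint homomorphisms. -/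
structure Hom (S : IntegralTorus.{u}) (T : IntegralTorus.{v}) where
  pull : T.L →ₗ[ℤ] S.L
  push : S.L' →ₗ[ℤ] T.L'
  adjoint : ∀ (l : T.L) (l' : S.L'), S.pairing (pull l) l' = T.pairing l (push l')

theorem Hom.adjoint_real {S : IntegralTorus.{u}} {T : IntegralTorus.{v}} (f : Hom S T)
    (x : ℝ ⊗[ℤ] T.L) (y : ℝ ⊗[ℤ] S.L') :
    realExtension S.pairing (f.pull.baseChange ℝ x) y
      = realExtension T.pairing x (f.push.baseChange ℝ y) := by
  induction x with
  | zero => simp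
  | add a b ha hb => simp [ha, hb]
  | tmul r a =>
    induction y with
    | zero => simp
    | add c d hc hd => simp only [map_add, hc, hd]
    | tmul s b => simp [f.adjoint]

/-- `(Coker f^#)^tf`, the largest torsion-free quotient of the cokernel of `f^#`. -/
abbrev Hom.cokerTF {S : IntegralTorus.{u}} {T : IntegralTorus.{v}} (f : Hom S T) : Type u :=
  (S.L ⧸ LinearMap.range f.pull) ⧸
    Submodule.torsion ℤ (S.L ⧸ LinearMap.range f.pull)

/-- The quotient map `Λ₁ → (Coker f^#)^tf`. -/
def Hom.toCokerTF {S : IntegralTorus.{u}} {T : IntegralTorus.{v}} (f : Hom S T) :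
    S.L →ₗ[ℤ] f.cokerTF :=
  (Submodule.torsion ℤ (S.L ⧸ LinearMap.range f.pull)).mkQ ∘ₗ (LinearMap.range f.pull).mkQ

theorem Hom.toCokerTF_surjective {S : IntegralTorus.{u}} {T : IntegralTorus.{v}} (f : Hom S T) :
    Function.Surjective f.toCokerTF :=
  (Submodule.mkQ_surjective _).comp (Submodule.mkQ_surjective _)

/-- The integration pairing restricted to `Ker f_#` descends to `Coker f^#`. -/
def Hom.cokerPairing {S : IntegralTorus.{u}} {T : IntegralTorus.{v}} (f : Hom S T) :
    (S.L ⧸ LinearMap.range f.pull) →ₗ[ℤ] LinearMap.ker f.push →ₗ[ℤ] ℝ :=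
  (LinearMap.range f.pull).liftQ (S.pairing.compl₂ (LinearMap.ker f.push).subtype) (by
    rintro _ ⟨l, rfl⟩
    ext ⟨l', hl'⟩
    simp [f.adjoint, LinearMap.mem_ker.1 hl'])

/-- The pairing `(Coker f^#)^tf × Ker f_# → ℝ` induced by the pairing of the source. -/
def Hom.kernelPairing {S : IntegralTorus.{u}} {T : IntegralTorus.{v}} (f : Hom S T) :
    f.cokerTF →ₗ[ℤ] LinearMap.ker f.push →ₗ[ℤ] ℝ :=
  (Submodule.torsion ℤ (S.L ⧸ LinearMap.range f.pull)).liftQ f.cokerPairing (by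
    rintro x ⟨⟨n, hn⟩, hx⟩
    ext l'
    have h : n • f.cokerPairing x = 0 := by
      rw [← map_smul]
      exact (congrArg f.cokerPairing hx).trans (map_zero _)
    have h0 : (n : ℝ) * f.cokerPairing x l' = 0 := by
      simpa using congrArg (fun q => q l') h
    have hn' : (n : ℝ) ≠ 0 := by exact_mod_cast nonZeroDivisors.ne_zero hn
    simpa [hn'] using h0)

theorem Hom.kernelPairing_apply {S : IntegralTorus.{u}} {T : IntegralTorus.{v}} (f : Hom S T)
    (l : S.L) (l' : LinearMap.ker f.push) :
    f.kernelPairing (f.toCokerTF l) l' = S.pairing l l' := rfl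

theorem Hom.kernelPairing_real {S : IntegralTorus.{u}} {T : IntegralTorus.{v}} (f : Hom S T)
    (x : ℝ ⊗[ℤ] S.L) (y : ℝ ⊗[ℤ] LinearMap.ker f.push) :
    realExtension f.kernelPairing (f.toCokerTF.baseChange ℝ x) y
      = realExtension S.pairing x ((LinearMap.ker f.push).subtype.baseChange ℝ y) := by
  induction x with
  | zero => simp
  | add a b ha hb => simp [ha, hb]
  | tmul r a =>
    induction y with
    | zero => simp
    | add c d hc hd => simp only [map_add, hc, hd]
    | tmul s b => simp [f.kernelPairing_apply]

theorem baseChange_injective {A B : Type*} [AddCommGroup A] [AddCommGroup B] (g : A →ₗ[ℤ] B)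
    (hg : Function.Injective g) : Function.Injective (g.baseChange ℝ) :=
  Module.Flat.lTensor_preserves_injective_linearMap (M := ℝ) g hg

theorem Hom.kernelPairing_nondegenerate {S : IntegralTorus.{u}} {T : IntegralTorus.{v}}
    (f : Hom S T) : (realExtension f.kernelPairing).Nondegenerate := by
  have hsurj : Function.Surjective (f.toCokerTF.baseChange ℝ) :=
    LinearMap.lTensor_surjective ℝ f.toCokerTF_surjective
  constructor
  · intro x hx
    obtain ⟨x, rfl⟩ := hsurj x
    have hle : LinearMap.ker (f.push.baseChange ℝ) ≤
        LinearMap.ker (realExtension S.pairing x) := by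
      intro z hz
      have hex := Module.Flat.lTensor_exact (R := ℤ) (M := ℝ)
        (LinearMap.exact_subtype_ker_map f.push)
      obtain ⟨y, rfl⟩ := (hex z).1 hz
      have := hx y
      rw [f.kernelPairing_real] at this
      exact this
    have hmem : realExtension S.pairing x ∈ LinearMap.range (f.push.baseChange ℝ).dualMap := by
      rw [LinearMap.range_dualMap_eq_dualAnnihilator_ker, Submodule.mem_dualAnnihilator]
      intro z hz
      exact hle hz
    obtain ⟨φ, hφ⟩ := hmem
    have hperf : (realExtension T.pairing).IsPerfPair :=
      LinearMap.IsPerfPair.of_injective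
        (LinearMap.ker_eq_bot.1 (LinearMap.separatingLeft_iff_ker_eq_bot.1 T.nondegenerate.1))
        (LinearMap.ker_eq_bot.1
          (LinearMap.separatingRight_iff_flip_ker_eq_bot.1 T.nondegenerate.2))
    obtain ⟨c, rfl⟩ := hperf.bijective_left.2 φ
    have hxc : x = f.pull.baseChange ℝ c := by
      rw [← sub_eq_zero]
      refine S.nondegenerate.1 _ fun y => ?_
      rw [map_sub, LinearMap.sub_apply, f.adjoint_real, ← hφ]
      simp
    have hcomp : f.toCokerTF ∘ₗ f.pull = 0 := by
      ext l
      have h0 : (LinearMap.range f.pull).mkQ (f.pull l) = 0 := by simp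
      change (Submodule.torsion ℤ (S.L ⧸ LinearMap.range f.pull)).mkQ
        ((LinearMap.range f.pull).mkQ (f.pull l)) = 0
      rw [h0, map_zero]
    rw [hxc, ← LinearMap.comp_apply, ← LinearMap.baseChange_comp, hcomp]
    simp
  · intro y hy
    apply baseChange_injective _ (LinearMap.ker f.push).injective_subtype
    rw [map_zero]
    refine S.nondegenerate.2 _ fun x => ?_
    rw [← f.kernelPairing_real]
    exact hy _

/-- The kernel torus `(Ker f)_0 = ((Coker f^#)^tf, Ker f_#, [·,·]_K)` of a homomorphism `f`. -/
def kernelTorus {S : IntegralTorus.{u}} {T : IntegralTorus.{v}} (f : Hom S T) :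
    IntegralTorus.{u} where
  L := f.cokerTF
  L' := LinearMap.ker f.push
  pairing := f.kernelPairing
  nondegenerate := f.kernelPairing_nondegenerate

/-- The natural homomorphism `i : (Ker f)_0 → S`. -/
def kernelIncl {S : IntegralTorus.{u}} {T : IntegralTorus.{v}} (f : Hom S T) :
    Hom (kernelTorus f) S where
  pull := f.toCokerTF
  push := (LinearMap.ker f.push).subtype
  adjoint _ _ := rfl

/-- A polarization: a homomorphism `ξ : Λ' → Λ` such that the bilinear form `[ξ(·), ·]` is
symmetric and positive definite on `Λ'_ℝ`. -/
structure Polarization (S : IntegralTorus.{u}) where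
  map : S.L' →ₗ[ℤ] S.L
  symm : ∀ a b : S.L', S.pairing (map a) b = S.pairing (map b) a
  posDef : ∀ x : ℝ ⊗[ℤ] S.L', x ≠ 0 → 0 < realExtension (S.pairing ∘ₗ map) x x

/-- A polarization is principal if it is bijective. -/
def Polarization.IsPrincipal {S : IntegralTorus.{u}} (ξ : Polarization S) : Prop :=
  Function.Bijective ξ.map

theorem Polarization.injective {S : IntegralTorus.{u}} (ξ : Polarization S) :
    Function.Injective ξ.map := by
  rw [injective_iff_map_eq_zero]
  intro a ha
  by_contra hne
  have hinj : Function.Injective (fun a : S.L' => (1 : ℝ) ⊗ₜ[ℤ] a) := by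
    have h := Module.Flat.rTensor_preserves_injective_linearMap (M := S.L')
      (Algebra.linearMap ℤ ℝ) (by exact Int.cast_injective)
    intro a b hab
    have : (1 : ℤ) ⊗ₜ[ℤ] a = (1 : ℤ) ⊗ₜ[ℤ] b := h (by simpa using hab)
    simpa using congrArg (TensorProduct.lid ℤ S.L') this
  have h1 : (1 : ℝ) ⊗ₜ[ℤ] a ≠ 0 := fun h => hne (hinj (by simpa using h))
  have := ξ.posDef _ h1
  simp [ha] at this

/-- The polarization `f^# ∘ ξ ∘ f_#` induced along a finite homomorphism `f : S → T`
(finiteness, `rk f = dim S`, is injectivity of `f_#`). -/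
def Polarization.induced {S : IntegralTorus.{u}} {T : IntegralTorus.{v}} (f : Hom S T)
    (hf : Function.Injective f.push) (ξ : Polarization T) : Polarization S where
  map := f.pull ∘ₗ ξ.map ∘ₗ f.push
  symm a b := by
    simp only [LinearMap.comp_apply, f.adjoint]
    exact ξ.symm _ _
  posDef x hx := by
    have key : ∀ x y : ℝ ⊗[ℤ] S.L', realExtension (S.pairing ∘ₗ f.pull ∘ₗ ξ.map ∘ₗ f.push) x y
        = realExtension (T.pairing ∘ₗ ξ.map) (f.push.baseChange ℝ x) (f.push.baseChange ℝ y) := by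
      intro x y
      induction x with
      | zero => simp
      | add a b ha hb => simp only [map_add, LinearMap.add_apply, ha, hb]
      | tmul r a =>
        induction y with
        | zero => simp
        | add c d hc hd => simp only [map_add, hc, hd]
        | tmul s b => simp [f.adjoint]
    rw [key]
    refine ξ.posDef _ fun h => hx (baseChange_injective _ hf ?_)
    rw [h, map_zero]

/-- A positive definite form composed with an isomorphism of lattices is nondegenerate. -/
theorem nondegenerate_of_posDef {A B : Type*} [AddCommGroup A] [AddCommGroup B]
    (e : B ≃ₗ[ℤ] A) (p : A →ₗ[ℤ] B →ₗ[ℤ] ℝ)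
    (h : ∀ x : ℝ ⊗[ℤ] B, x ≠ 0 → 0 < realExtension (p ∘ₗ e.toLinearMap) x x) :
    (realExtension p).Nondegenerate := by
  have key : ∀ x y : ℝ ⊗[ℤ] B, realExtension (p ∘ₗ e.toLinearMap) x y
      = realExtension p (e.toLinearMap.baseChange ℝ x) y := by
    intro x y
    induction x with
    | zero => simp
    | add a b ha hb => simp only [map_add, LinearMap.add_apply, ha, hb]
    | tmul r a =>
      induction y with
      | zero => simp
      | add c d hc hd => simp only [map_add, hc, hd]
      | tmul s b => simp
  constructor
  · intro x hx
    obtain ⟨z, rfl⟩ := LinearMap.lTensor_surjective ℝ e.surjective x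
    by_contra hne
    have hz : z ≠ 0 := by
      rintro rfl
      exact hne (map_zero _)
    have := h z hz
    rw [key] at this
    exact this.ne' (hx z)
  · intro y hy
    by_contra hne
    have := h y hne
    rw [key, hy] at this
    exact lt_irrefl _ this

/-- The principalization `(Im ξ, Λ', [·,·])` of a polarized integral torus. -/
def principalization {S : IntegralTorus.{u}} (ξ : Polarization S) : IntegralTorus.{u} where
  L := LinearMap.range ξ.map
  L' := S.L'
  pairing := S.pairing ∘ₗ (LinearMap.range ξ.map).subtype
  nondegenerate := nondegenerate_of_posDef (LinearEquiv.ofInjective ξ.map ξ.injective) _ ξ.posDef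

/-- The principal polarization `ξ : Λ' → Im ξ` of the principalization. -/
def Polarization.toPrincipalization {S : IntegralTorus.{u}} (ξ : Polarization S) :
    Polarization (principalization ξ) where
  map := ξ.map.rangeRestrict
  symm := ξ.symm
  posDef := ξ.posDef

end IntegralTorus

/-- A principally polarized tropical abelian variety. -/
structure PPTAV where
  torus : IntegralTorus.{u}
  polarization : torus.Polarization
  principal : polarization.IsPrincipal

/-- An isomorphism of pptavs: an invertible homomorphism `(f^#, f_#)` of integral tori for which
the polarization of the target induces that of the source, `f^# ∘ ξ₂ ∘ f_# = ξ₁`. -/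
structure PPTAV.Iso (P : PPTAV.{u}) (Q : PPTAV.{v}) where
  pull : Q.torus.L ≃ₗ[ℤ] P.torus.L
  push : P.torus.L' ≃ₗ[ℤ] Q.torus.L'
  adjoint : ∀ l l', P.torus.pairing (pull l) l' = Q.torus.pairing l (push l')
  polarization : ∀ l', pull (Q.polarization.map (push l')) = P.polarization.map l'

/-- The principalization of a polarized integral torus as a pptav. -/
def IntegralTorus.Polarization.principalized {S : IntegralTorus.{u}} (ξ : S.Polarization) :
    PPTAV.{u} where
  torus := IntegralTorus.principalization ξ
  polarization := ξ.toPrincipalization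
  principal := ⟨fun _ _ h => ξ.injective (congrArg Subtype.val h),
    fun ⟨_, l', hl'⟩ => ⟨l', Subtype.ext hl'⟩⟩

open scoped Classical

/-! ### Graphs with half-edges -/

/-- A finite graph: vertices, half-edges, a root map and a fixed-point-free involution on the
half-edges. Loops and multiple edges are allowed. -/
structure HGraph where
  V : Type u
  H : Type u
  [finV : Fintype V]
  [finH : Fintype H]
  root : H → V
  inv : H → H
  inv_inv : ∀ h, inv (inv h) = h
  inv_ne : ∀ h, inv h ≠ h

attribute [instance] HGraph.finV HGraph.finH

namespace HGraph

/-- Two half-edges are equivalent if they belong to the same orbit of the involution. -/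
def edgeSetoid (G : HGraph.{u}) : Setoid G.H where
  r h h' := h' = h ∨ h' = G.inv h
  iseqv :=
    { refl := fun _ => Or.inl rfl
      symm := by
        rintro h h' (rfl | rfl)
        · exact Or.inl rfl
        · exact Or.inr (G.inv_inv _).symm
      trans := by
        rintro h h' h'' (rfl | rfl) (rfl | rfl)
        · exact Or.inl rfl
        · exact Or.inr rfl
        · exact Or.inr rfl
        · exact Or.inl (G.inv_inv _) }

/-- The edges of a graph are the orbits of the involution on half-edges. -/
def E (G : HGraph.{u}) : Type u := Quotient G.edgeSetoid

/-- The edge containing a half-edge. -/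
def edge (G : HGraph.{u}) (h : G.H) : G.E := Quotient.mk G.edgeSetoid h

theorem edge_eq_iff (G : HGraph.{u}) {h h' : G.H} :
    G.edge h = G.edge h' ↔ h' = h ∨ h' = G.inv h := Quotient.eq (r := G.edgeSetoid)

@[simp]
theorem edge_inv (G : HGraph.{u}) (h : G.H) : G.edge (G.inv h) = G.edge h :=
  (G.edge_eq_iff.2 (Or.inr rfl)).symm

theorem edge_surjective (G : HGraph.{u}) : Function.Surjective G.edge := Quotient.mk_surjective

instance (G : HGraph.{u}) : Finite G.E := Finite.of_surjective _ G.edge_surjective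

instance (G : HGraph.{u}) : Fintype G.E := Fintype.ofFinite _

/-- The adjacency relation of the graph `G \ S` obtained by removing the edges in `S` and retaining
all vertices. Loops and multiplicities are forgotten, which does not affect connectivity. -/
def delete (G : HGraph.{u}) (S : Set G.E) : SimpleGraph G.V where
  Adj v w := v ≠ w ∧ ∃ h, G.root h = v ∧ G.root (G.inv h) = w ∧ G.edge h ∉ S
  symm := ⟨by
    rintro v w ⟨hne, h, hv, hw, hS⟩
    exact ⟨hne.symm, G.inv h, hw, by rw [G.inv_inv, hv], by rwa [edge_inv]⟩⟩
  loopless := ⟨fun _ h => h.1 rfl⟩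

theorem delete_reachable (G : HGraph.{u}) {S : Set G.E} {h : G.H} (hS : G.edge h ∉ S) :
    (G.delete S).Reachable (G.root h) (G.root (G.inv h)) := by
  by_cases heq : G.root h = G.root (G.inv h)
  · rw [← heq]
  · exact SimpleGraph.Adj.reachable ⟨heq, h, rfl, rfl, hS⟩

/-- A function on the vertices that takes equal values at the ends of each remaining edge is
constant on the connected components. -/
theorem eq_of_reachable (G : HGraph.{u}) {S : Set G.E} {α : Type*} (f : G.V → α)
    (hf : ∀ h, G.edge h ∉ S → f (G.root h) = f (G.root (G.inv h))) {v w : G.V}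
    (hvw : (G.delete S).Reachable v w) : f v = f w := by
  obtain ⟨p⟩ := hvw
  induction p with
  | nil => rfl
  | cons hadj _ ih =>
    obtain ⟨_, h, rfl, rfl, hS⟩ := hadj
    exact (hf h hS).trans ih

/-- A graph is connected (in particular nonempty). -/
def Connected (G : HGraph.{u}) : Prop := (G.delete ∅).Connected

/-- An orientation: one half-edge of every edge gets `+1`, the other one `-1`. -/
structure Orientation (G : HGraph.{u}) where
  sign : G.H → ℤˣ
  sign_inv : ∀ h, sign (G.inv h) = -sign h

/-- Simplicial homology `H_1(G, ℤ)` of an oriented graph: the integral 1-chains `γ` with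
`∑_{h ∈ T_v G} o(h) γ(h) = 0` at every vertex `v`. -/
def H1 (G : HGraph.{u}) (o : G.Orientation) : Submodule ℤ (G.E → ℤ) where
  carrier := {γ | ∀ v, ∑ h : G.H with G.root h = v, (o.sign h : ℤ) * γ (G.edge h) = 0}
  zero_mem' := by simp
  add_mem' := by
    intro a b ha hb v
    simp only [Pi.add_apply, mul_add, Finset.sum_add_distrib, ha v, hb v, add_zero]
  smul_mem' := by
    intro c a ha v
    have h := ha v
    simp only [Pi.smul_apply, smul_eq_mul]
    rw [← mul_zero c, ← h, Finset.mul_sum]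
    exact Finset.sum_congr rfl fun _ _ => by ring

theorem mem_H1 {G : HGraph.{u}} {o : G.Orientation} {γ : G.E → ℤ} : γ ∈ G.H1 o ↔
    ∀ v, ∑ h : G.H with G.root h = v, (o.sign h : ℤ) * γ (G.edge h) = 0 := Iff.rfl

/-- The integration pairing `∑_e γ(e) δ(e) ℓ(e)` on cycles, with respect to edge lengths `ℓ`. -/
def integrationPairing (G : HGraph.{u}) (o : G.Orientation) (len : G.E → ℝ) :
    G.H1 o →ₗ[ℤ] G.H1 o →ₗ[ℤ] ℝ :=
  LinearMap.mk₂ ℤ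
    (fun γ δ => ∑ e, (γ.1 e : ℝ) * (δ.1 e : ℝ) * len e)
    (by intro a b c; simp [add_mul, Finset.sum_add_distrib])
    (by intro n a b; simp [Finset.mul_sum, mul_assoc])
    (by intro a b c; simp [add_mul, mul_add, Finset.sum_add_distrib])
    (by intro n a b; simp [Finset.mul_sum, mul_assoc, mul_left_comm])

theorem integrationPairing_apply (G : HGraph.{u}) (o : G.Orientation) (len : G.E → ℝ)
    (γ δ : G.H1 o) : G.integrationPairing o len γ δ = ∑ e, (γ.1 e : ℝ) * (δ.1 e : ℝ) * len e := rfl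

/-- Real homology as real-valued chains. -/
def realChain (G : HGraph.{u}) (o : G.Orientation) : (ℝ ⊗[ℤ] G.H1 o) →ₗ[ℝ] (G.E → ℝ) :=
  (TensorProduct.piScalarRight ℤ ℝ ℝ G.E).toLinearMap ∘ₗ (G.H1 o).subtype.baseChange ℝ

theorem realChain_injective (G : HGraph.{u}) (o : G.Orientation) :
    Function.Injective (G.realChain o) :=
  (TensorProduct.piScalarRight ℤ ℝ ℝ G.E).injective.comp
    (IntegralTorus.baseChange_injective _ (G.H1 o).injective_subtype)

theorem integrationPairing_real (G : HGraph.{u}) (o : G.Orientation) (len : G.E → ℝ)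
    (x y : ℝ ⊗[ℤ] G.H1 o) : realExtension (G.integrationPairing o len) x y =
      ∑ e, G.realChain o x e * G.realChain o y e * len e := by
  induction x with
  | zero => simp
  | add a b ha hb => simp [ha, hb, add_mul, Finset.sum_add_distrib]
  | tmul r a =>
    induction y with
    | zero => simp
    | add c d hc hd =>
      simp only [map_add, hc, hd, Pi.add_apply, mul_add, add_mul, Finset.sum_add_distrib]
    | tmul s b =>
      simp only [realExtension_tmul, integrationPairing_apply, Finset.mul_sum]
      refine Finset.sum_congr rfl fun e _ => ?_
      simp [realChain, TensorProduct.piScalarRight_apply]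
      ring

theorem integrationPairing_posDef (G : HGraph.{u}) (o : G.Orientation) (len : G.E → ℝ)
    (hlen : ∀ e, 0 < len e) (x : ℝ ⊗[ℤ] G.H1 o) (hx : x ≠ 0) :
    0 < realExtension (G.integrationPairing o len) x x := by
  rw [integrationPairing_real]
  have hne : G.realChain o x ≠ 0 := fun h =>
    hx (G.realChain_injective o (by rw [h, map_zero]))
  obtain ⟨e, he⟩ := Function.ne_iff.1 hne
  refine Finset.sum_pos' (fun e _ => mul_nonneg (mul_self_nonneg _) (hlen e).le)
    ⟨e, Finset.mem_univ _, mul_pos (mul_self_pos.2 he) (hlen e)⟩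

/-- The tropical Jacobian `(Ω¹, H_1, [·,·])`, with `Ω¹ = H_1` as groups. -/
def jacobian (G : HGraph.{u}) (o : G.Orientation) (len : G.E → ℝ) (hlen : ∀ e, 0 < len e) :
    IntegralTorus.{u} where
  L := G.H1 o
  L' := G.H1 o
  pairing := G.integrationPairing o len
  nondegenerate := IntegralTorus.nondegenerate_of_posDef (LinearEquiv.refl ℤ _) _
    (G.integrationPairing_posDef o len hlen)

/-- The principal polarization `H_1 = Ω¹` of the Jacobian. -/
def jacobianPolarization (G : HGraph.{u}) (o : G.Orientation) (len : G.E → ℝ)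
    (hlen : ∀ e, 0 < len e) : (G.jacobian o len hlen).Polarization where
  map := (LinearMap.id : G.H1 o →ₗ[ℤ] G.H1 o)
  symm a b := by
    change (∑ e, (a.1 e : ℝ) * (b.1 e : ℝ) * len e) = ∑ e, (b.1 e : ℝ) * (a.1 e : ℝ) * len e
    exact Finset.sum_congr rfl fun e _ => by ring
  posDef := G.integrationPairing_posDef o len hlen

/-- A morphism of graphs: compatible maps on vertices and half-edges. -/
structure Hom (G' G : HGraph.{u}) where
  onV : G'.V → G.V
  onH : G'.H → G.H
  root_onH : ∀ h, G.root (onH h) = onV (G'.root h)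
  inv_onH : ∀ h, G.inv (onH h) = onH (G'.inv h)

/-- The map on edges induced by a morphism. -/
def Hom.onE {G' G : HGraph.{u}} (f : Hom G' G) : G'.E → G.E :=
  Quotient.lift (fun h => G.edge (f.onH h)) (by
    rintro h _ (rfl | rfl)
    · rfl
    · rw [← f.inv_onH, edge_inv])

@[simp]
theorem Hom.onE_edge {G' G : HGraph.{u}} (f : Hom G' G) (h : G'.H) :
    f.onE (G'.edge h) = G.edge (f.onH h) := rfl

/-- A harmonic morphism: a morphism with positive local degrees that agree on the two half-edges of
an edge and are balanced at every vertex. -/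
structure Harmonic (G' G : HGraph.{u}) extends Hom G' G where
  degV : G'.V → ℕ
  degH : G'.H → ℕ
  degV_pos : ∀ v, 0 < degV v
  degH_pos : ∀ h, 0 < degH h
  degH_inv : ∀ h, degH (G'.inv h) = degH h
  balanced : ∀ (v' : G'.V) (h : G.H), G.root h = onV v' →
    degV v' = ∑ h' : G'.H with G'.root h' = v' ∧ onH h' = h, degH h'

/-- The local degree along an edge. -/
def Harmonic.degE {G' G : HGraph.{u}} (p : Harmonic G' G) : G'.E → ℕ :=
  Quotient.lift p.degH (by
    rintro h _ (rfl | rfl)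
    · rfl
    · rw [p.degH_inv])

@[simp]
theorem Harmonic.degE_edge {G' G : HGraph.{u}} (p : Harmonic G' G) (h : G'.H) :
    p.degE (G'.edge h) = p.degH h := rfl

/-- The orientation of the source induced by an orientation of the target. -/
def Orientation.comap {G' G : HGraph.{u}} (f : Hom G' G) (o : G.Orientation) :
    G'.Orientation where
  sign h := o.sign (f.onH h)
  sign_inv h := by rw [← f.inv_onH, o.sign_inv]

namespace Harmonic

variable {G' G : HGraph.{u}} (p : Harmonic G' G)

/-- Summation over a fibre of vertices equals summation over a fibre of half-edges. -/
theorem sum_fiber {R : Type*} [CommSemiring R] (g : G'.V → R) (h : G.H) :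
    ∑ v' : G'.V with p.onV v' = G.root h, (p.degV v' : R) * g v' =
      ∑ h' : G'.H with p.onH h' = h, (p.degH h' : R) * g (G'.root h') := by
  rw [← Finset.sum_fiberwise_of_maps_to (s := Finset.univ.filter fun h' => p.onH h' = h)
    (t := Finset.univ.filter fun v' => p.onV v' = G.root h) (g := G'.root)]
  · refine Finset.sum_congr rfl fun v' hv' => ?_
    rw [p.balanced v' h (Finset.mem_filter.1 hv').2.symm, Nat.cast_sum, Finset.sum_mul,
      Finset.filter_filter]
    refine Finset.sum_congr ?_ fun h' hh' => ?_
    · ext h'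
      simp [and_comm]
    · rw [(Finset.mem_filter.1 hh').2.2]
  · intro h' hh'
    rw [Finset.mem_filter] at hh' ⊢
    exact ⟨Finset.mem_univ _, by rw [← hh'.2, p.root_onH]⟩

/-- The half-edges above `h` correspond to the edges above the edge of `h`. -/
theorem sum_edge_fiber {R : Type*} [AddCommMonoid R] (g : G'.E → R) (h : G.H) :
    ∑ h' : G'.H with p.onH h' = h, g (G'.edge h') =
      ∑ e' : G'.E with p.onE e' = G.edge h, g e' := by
  refine Finset.sum_bij (fun h' _ => G'.edge h') ?_ ?_ ?_ ?_
  · intro h' hh'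
    rw [Finset.mem_filter] at hh' ⊢
    exact ⟨Finset.mem_univ _, by rw [Hom.onE_edge, hh'.2]⟩
  · intro a ha b hb hab
    rw [Finset.mem_filter] at ha hb
    rcases G'.edge_eq_iff.1 hab with h1 | h1
    · exact h1.symm
    · exfalso
      apply G.inv_ne h
      rw [← ha.2, p.inv_onH, ← h1, hb.2, ha.2]
  · intro e' he'
    obtain ⟨a, rfl⟩ := G'.edge_surjective e'
    rw [Finset.mem_filter, Hom.onE_edge] at he'
    rcases G.edge_eq_iff.1 he'.2 with h1 | h1
    · exact ⟨a, by simp [h1], rfl⟩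
    · exact ⟨G'.inv a, by simp [h1, p.inv_onH], by simp⟩
  · intro _ _
    rfl

/-- Push-forward of cycles, `∑ γ(ẽ) ẽ ↦ ∑ γ(ẽ) p(ẽ)`. -/
def push (o : G.Orientation) : G'.H1 (o.comap p.toHom) →ₗ[ℤ] G.H1 o where
  toFun γ := ⟨fun e => ∑ e' : G'.E with p.onE e' = e, γ.1 e', by
    intro v
    have h1 : ∀ h : G.H, (o.sign h : ℤ) * ∑ e' : G'.E with p.onE e' = G.edge h, γ.1 e' =
        ∑ h' : G'.H with p.onH h' = h, (o.sign (p.onH h') : ℤ) * γ.1 (G'.edge h') := by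
      intro h
      rw [← p.sum_edge_fiber, Finset.mul_sum]
      refine Finset.sum_congr rfl fun h' hh' => ?_
      rw [(Finset.mem_filter.1 hh').2]
    simp only [h1]
    have hl := Finset.sum_fiberwise_of_maps_to
      (s := Finset.univ.filter fun h' : G'.H => p.onV (G'.root h') = v)
      (t := Finset.univ.filter fun h : G.H => G.root h = v) (g := p.onH)
      (f := fun h' => (o.sign (p.onH h') : ℤ) * γ.1 (G'.edge h')) (by
        intro h' hh'
        rw [Finset.mem_filter] at hh' ⊢
        exact ⟨Finset.mem_univ _, by rw [p.root_onH, hh'.2]⟩)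
    have hr := Finset.sum_fiberwise_of_maps_to
      (s := Finset.univ.filter fun h' : G'.H => p.onV (G'.root h') = v)
      (t := Finset.univ.filter fun v' : G'.V => p.onV v' = v) (g := G'.root)
      (f := fun h' => (o.sign (p.onH h') : ℤ) * γ.1 (G'.edge h')) (by
        intro h' hh'
        rw [Finset.mem_filter] at hh' ⊢
        exact ⟨Finset.mem_univ _, hh'.2⟩)
    trans ∑ h' : G'.H with p.onV (G'.root h') = v, (o.sign (p.onH h') : ℤ) * γ.1 (G'.edge h')
    · rw [← hl]
      refine Finset.sum_congr rfl fun h hh => ?_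
      rw [Finset.filter_filter]
      refine Finset.sum_congr ?_ fun _ _ => rfl
      ext h'
      simp only [Finset.mem_filter, Finset.mem_univ, true_and]
      constructor
      · intro h2
        exact ⟨by rw [← p.root_onH, h2, (Finset.mem_filter.1 hh).2], h2⟩
      · exact fun h2 => h2.2
    · rw [← hr]
      refine Finset.sum_eq_zero fun v' hv' => ?_
      rw [Finset.filter_filter, ← γ.2 v']
      refine Finset.sum_congr ?_ fun _ _ => rfl
      ext h'
      simp only [Finset.mem_filter, Finset.mem_univ, true_and]
      constructor
      · exact fun h2 => h2.2
      · intro h2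
        exact ⟨by rw [h2, (Finset.mem_filter.1 hv').2], h2⟩⟩
  map_add' a b := by
    ext e
    simp [Finset.sum_add_distrib]
  map_smul' c a := by
    ext e
    simp [Finset.mul_sum]

/-- Pull-back of 1-forms, `∑ γ(e) de ↦ ∑ γ(e) ∑_{ẽ over e} d(ẽ) dẽ`. -/
def pull (o : G.Orientation) : G.H1 o →ₗ[ℤ] G'.H1 (o.comap p.toHom) where
  toFun γ := ⟨fun e' => (p.degE e' : ℤ) * γ.1 (p.onE e'), by
    intro v'
    have h := Finset.sum_fiberwise_of_maps_to
      (s := Finset.univ.filter fun h' : G'.H => G'.root h' = v')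
      (t := Finset.univ.filter fun h : G.H => G.root h = p.onV v') (g := p.onH)
      (f := fun h' => (o.sign (p.onH h') : ℤ) *
        ((p.degH h' : ℤ) * γ.1 (G.edge (p.onH h')))) (by
        intro h' hh'
        rw [Finset.mem_filter] at hh' ⊢
        exact ⟨Finset.mem_univ _, by rw [p.root_onH, hh'.2]⟩)
    refine h.symm.trans ?_
    have h2 := γ.2 (p.onV v')
    rw [← mul_zero (p.degV v' : ℤ), ← h2, Finset.mul_sum]
    refine Finset.sum_congr rfl fun h hh => ?_
    rw [p.balanced v' h (Finset.mem_filter.1 hh).2, Nat.cast_sum, Finset.sum_mul,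
      Finset.filter_filter]
    refine Finset.sum_congr rfl fun h' hh' => ?_
    rw [(Finset.mem_filter.1 hh').2.2]
    ring⟩
  map_add' a b := by
    ext e
    simp [mul_add]
  map_smul' c a := by
    ext e
    simp [mul_left_comm]

theorem push_apply (o : G.Orientation) (γ : G'.H1 (o.comap p.toHom)) (e : G.E) :
    (p.push o γ).1 e = ∑ e' : G'.E with p.onE e' = e, γ.1 e' := rfl

theorem pull_apply (o : G.Orientation) (γ : G.H1 o) (e' : G'.E) :
    (p.pull o γ).1 e' = (p.degE e' : ℤ) * γ.1 (p.onE e') := rfl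

/-- The projection formula `[p^* γ, δ] = [γ, p_* δ]`. -/
theorem integrationPairing_pull (o : G.Orientation) {len' : G'.E → ℝ} {len : G.E → ℝ}
    (hlen : ∀ e', len (p.onE e') = p.degE e' * len' e')
    (γ : G.H1 o) (δ : G'.H1 (o.comap p.toHom)) :
    G'.integrationPairing _ len' (p.pull o γ) δ = G.integrationPairing o len γ (p.push o δ) := by
  rw [integrationPairing_apply, integrationPairing_apply,
    ← Finset.sum_fiberwise_of_maps_to (s := Finset.univ) (t := Finset.univ)
      (g := p.onE) (fun _ _ => Finset.mem_univ _)]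
  refine Finset.sum_congr rfl fun e _ => ?_
  rw [push_apply, Int.cast_sum, Finset.mul_sum, Finset.sum_mul]
  refine Finset.sum_congr rfl fun e' he' => ?_
  obtain rfl := (Finset.mem_filter.1 he').2
  rw [pull_apply, hlen]
  push_cast
  ring

end Harmonic

end HGraph

/-! ### Double covers -/

/-- A double cover of connected graphs: a harmonic morphism of global degree two. -/
structure DoubleCover where
  src : HGraph.{u}
  tgt : HGraph.{u}
  p : HGraph.Harmonic src tgt
  degree_two : ∀ v : tgt.V, ∑ v' : src.V with p.onV v' = v, p.degV v' = 2
  src_connected : src.Connected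
  tgt_connected : tgt.Connected

namespace DoubleCover

variable (π : DoubleCover.{u})

/-- An edge of the target is dilated if there is an edge of local degree two above it. -/
def IsDilated (e : π.tgt.E) : Prop := ∃ e', π.p.onE e' = e ∧ π.p.degE e' = 2

/-- The set `E_ud` of undilated edges of the target. -/
abbrev Eud : Type u := {e : π.tgt.E // ¬ π.IsDilated e}

/-- A set of undilated edges as a set of edges of the target. -/
def edges (F : Set π.Eud) : Set π.tgt.E := Subtype.val '' F

/-- The preimage in the source of a set of undilated edges. -/
def liftedEdges (F : Set π.Eud) : Set π.src.E := π.p.onE ⁻¹' π.edges F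

/-- The double cover obtained by removing the edges `F` of the target and their preimages is
relatively connected: the preimage of every connected component of `G \ F` is connected, i.e.
any two vertices above the same component are joined in the source. -/
def RelConnected (F : Set π.Eud) : Prop :=
  ∀ v' w' : π.src.V, (π.tgt.delete (π.edges F)).Reachable (π.p.onV v') (π.p.onV w') →
    (π.src.delete (π.liftedEdges F)).Reachable v' w'

/-- Rational functions on the vertices of the source with vanishing (weighted) fibre sums. -/
def oddFun : Submodule ℚ (π.src.V → ℚ) where
  carrier := {f | ∀ v, ∑ v' : π.src.V with π.p.onV v' = v, (π.p.degV v' : ℚ) * f v' = 0}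
  zero_mem' := by simp
  add_mem' := by
    intro a b ha hb v
    simp only [Pi.add_apply, mul_add, Finset.sum_add_distrib, ha v, hb v, add_zero]
  smul_mem' := by
    intro c a ha v
    have h := ha v
    simp only [Pi.smul_apply, smul_eq_mul]
    rw [← mul_zero c, ← h, Finset.mul_sum]
    exact Finset.sum_congr rfl fun _ _ => by ring

theorem degree_two_half (h : π.tgt.H) :
    ∑ h' : π.src.H with π.p.onH h' = h, π.p.degH h' = 2 := by
  have := π.p.sum_fiber (R := ℕ) (fun _ => 1) h
  simp only [Nat.cast_id, mul_one] at this
  rw [← this, π.degree_two]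

theorem relConnected_iff (F : Set π.Eud) : π.RelConnected F ↔ ∀ f ∈ π.oddFun,
    (∀ h', π.src.edge h' ∉ π.liftedEdges F →
      f (π.src.root h') = f (π.src.root (π.src.inv h'))) → f = 0 := by
  constructor
  · intro hF f hf hloc
    ext v'
    have hv := hf (π.p.onV v')
    have h1 : ∀ w' ∈ Finset.univ.filter (fun w' : π.src.V => π.p.onV w' = π.p.onV v'),
        (π.p.degV w' : ℚ) * f w' = (π.p.degV w' : ℚ) * f v' := by
      intro w' hw'
      rw [π.src.eq_of_reachable f hloc
        (hF w' v' (by rw [(Finset.mem_filter.1 hw').2]))]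
    rw [Finset.sum_congr rfl h1, ← Finset.sum_mul, ← Nat.cast_sum, π.degree_two] at hv
    simpa using hv
  · intro hF v₀ w₀ hvw
    by_contra hnot
    let C : π.src.V → ℚ := fun u' =>
      if (π.src.delete (π.liftedEdges F)).Reachable v₀ u' then 1 else 0
    let N : π.tgt.V → ℚ := fun u =>
      ∑ u' : π.src.V with π.p.onV u' = u, (π.p.degV u' : ℚ) * C u'
    have hC : ∀ h', π.src.edge h' ∉ π.liftedEdges F →
        C (π.src.root h') = C (π.src.root (π.src.inv h')) := by
      intro h' hh'
      have hr := π.src.delete_reachable hh'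
      have : (π.src.delete (π.liftedEdges F)).Reachable v₀ (π.src.root h') ↔
          (π.src.delete (π.liftedEdges F)).Reachable v₀ (π.src.root (π.src.inv h')) :=
        ⟨fun h => h.trans hr, fun h => h.trans hr.symm⟩
      simp only [C, this]
    have hN : ∀ h, π.tgt.edge h ∉ π.edges F →
        N (π.tgt.root h) = N (π.tgt.root (π.tgt.inv h)) := by
      intro h hh
      simp only [N]
      rw [π.p.sum_fiber, π.p.sum_fiber]
      refine Finset.sum_bij (fun h' _ => π.src.inv h') ?_ ?_ ?_ ?_
      · intro h' hh'
        rw [Finset.mem_filter] at hh' ⊢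
        exact ⟨Finset.mem_univ _, by rw [← π.p.inv_onH, hh'.2]⟩
      · intro a _ b _ hab
        rw [← π.src.inv_inv a, hab, π.src.inv_inv]
      · intro b hb
        rw [Finset.mem_filter] at hb
        exact ⟨π.src.inv b, by simp [← π.p.inv_onH, hb.2, π.tgt.inv_inv], π.src.inv_inv b⟩
      · intro h' hh'
        rw [π.p.degH_inv, hC h']
        rw [Finset.mem_filter] at hh'
        simpa [liftedEdges, hh'.2] using hh
    have hf : (fun u' => 2 * C u' - N (π.p.onV u')) ∈ π.oddFun := by
      intro u
      have h1 : ∀ u' ∈ Finset.univ.filter (fun u' : π.src.V => π.p.onV u' = u),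
          (π.p.degV u' : ℚ) * (2 * C u' - N (π.p.onV u')) =
            2 * ((π.p.degV u' : ℚ) * C u') - (π.p.degV u' : ℚ) * N u := by
        intro u' hu'
        rw [(Finset.mem_filter.1 hu').2]
        ring
      rw [Finset.sum_congr rfl h1, Finset.sum_sub_distrib, ← Finset.mul_sum, ← Finset.sum_mul,
        ← Nat.cast_sum, π.degree_two]
      simp [N]
    have h0 := hF _ hf (by
      intro h' hh'
      rw [hC h' hh', ← π.p.root_onH, hN _ (by simpa [liftedEdges] using hh'), π.p.inv_onH,
        π.p.root_onH])
    have hv := congrFun h0 v₀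
    have hw := congrFun h0 w₀
    have hNvw := π.tgt.eq_of_reachable N hN hvw
    simp only [C, SimpleGraph.Reachable.refl, if_true, hnot, if_false, Pi.zero_apply] at hv hw
    linarith

theorem relConnected_empty : π.RelConnected ∅ := by
  intro v' w' _
  have : π.liftedEdges ∅ = ∅ := by simp [liftedEdges, edges]
  rw [this]
  exact π.src_connected.preconnected v' w'

theorem exists_lift (e : π.tgt.E) : ∃ h', π.p.onE (π.src.edge h') = e := by
  obtain ⟨h, rfl⟩ := π.tgt.edge_surjective e
  by_contra! hne
  have h2 := π.degree_two_half h
  rw [Finset.filter_eq_empty_iff.2, Finset.sum_empty] at h2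
  · omega
  · intro h' _ hh'
    exact hne h' (by rw [HGraph.Hom.onE_edge, hh'])

/-- The difference of the values of an odd function at the ends of a lift of the edge `e`. -/
def diffOn (e : π.Eud) : Module.Dual ℚ π.oddFun :=
  ((LinearMap.proj (π.src.root (π.exists_lift e.1).choose) : (π.src.V → ℚ) →ₗ[ℚ] ℚ) -
    LinearMap.proj (π.src.root (π.src.inv (π.exists_lift e.1).choose))) ∘ₗ π.oddFun.subtype

theorem diffOn_apply (e : π.Eud) (f : π.oddFun) : π.diffOn e f =
    f.1 (π.src.root (π.exists_lift e.1).choose) -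
      f.1 (π.src.root (π.src.inv (π.exists_lift e.1).choose)) := rfl

theorem sum_diff {f : π.src.V → ℚ} (hf : f ∈ π.oddFun) (h : π.tgt.H) :
    ∑ h' : π.src.H with π.p.onH h' = h, (π.p.degH h' : ℚ) *
      (f (π.src.root h') - f (π.src.root (π.src.inv h'))) = 0 := by
  have h1 := hf (π.tgt.root h)
  rw [π.p.sum_fiber] at h1
  have h2 := hf (π.tgt.root (π.tgt.inv h))
  rw [π.p.sum_fiber] at h2
  have h3 : ∑ h' : π.src.H with π.p.onH h' = π.tgt.inv h, (π.p.degH h' : ℚ) * f (π.src.root h') =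
      ∑ h' : π.src.H with π.p.onH h' = h, (π.p.degH h' : ℚ) *
        f (π.src.root (π.src.inv h')) := by
    symm
    refine Finset.sum_bij (fun h' _ => π.src.inv h') ?_ ?_ ?_ ?_
    · intro h' hh'
      rw [Finset.mem_filter] at hh' ⊢
      exact ⟨Finset.mem_univ _, by rw [← π.p.inv_onH, hh'.2]⟩
    · intro a _ b _ hab
      rw [← π.src.inv_inv a, hab, π.src.inv_inv]
    · intro b hb
      rw [Finset.mem_filter] at hb
      exact ⟨π.src.inv b, by simp [← π.p.inv_onH, hb.2, π.tgt.inv_inv], π.src.inv_inv b⟩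
    · intro h' _
      rw [π.p.degH_inv]
  simp only [mul_sub, Finset.sum_sub_distrib]
  rw [h1, ← h3, h2, sub_zero]

theorem fibre_pair {α : Type*} (s : Finset α) (d : α → ℕ) (hd : ∀ a, 0 < d a)
    (hs : ∑ a ∈ s, d a = 2) (g : α → ℚ) (hg : ∑ a ∈ s, (d a : ℚ) * g a = 0) (a : α) (ha : a ∈ s)
    (h : g a = 0 ∨ d a = 2) : ∀ b ∈ s, g b = 0 := by
  have h1 := Finset.add_sum_erase s d ha
  have h2 := Finset.add_sum_erase s (fun a => (d a : ℚ) * g a) ha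
  have hda := hd a
  have hne : ∀ x : α, (d x : ℚ) ≠ 0 := fun x => by exact_mod_cast (hd x).ne'
  have hempty : ∀ t : Finset α, ∑ x ∈ t, d x = 0 → t = ∅ := by
    intro t ht
    by_contra hn
    have := Finset.sum_pos (fun x _ => hd x) (Finset.nonempty_iff_ne_empty.2 hn) (s := t)
    omega
  have hga : g a = 0 := by
    rcases h with h | h
    · exact h
    · rw [hempty (s.erase a) (by omega)] at h2
      simp only [Finset.sum_empty, add_zero] at h2
      exact (mul_eq_zero.1 (h2.trans hg)).resolve_left (hne a)
  intro b hb
  by_cases hba : b = a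
  · rw [hba, hga]
  · have hb' : b ∈ s.erase a := Finset.mem_erase.2 ⟨hba, hb⟩
    have h3 := Finset.add_sum_erase (s.erase a) d hb'
    have h4 := Finset.add_sum_erase (s.erase a) (fun a => (d a : ℚ) * g a) hb'
    have hdb := hd b
    rw [hempty ((s.erase a).erase b) (by omega)] at h4
    simp only [Finset.sum_empty, add_zero] at h4
    rw [hg, ← h4, hga, mul_zero, zero_add] at h2
    exact (mul_eq_zero.1 h2).resolve_left (hne b)

theorem diff_eq_zero {f : π.src.V → ℚ} (hf : f ∈ π.oddFun) (a b : π.src.H)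
    (hab : π.p.onE (π.src.edge a) = π.p.onE (π.src.edge b))
    (ha : f (π.src.root a) - f (π.src.root (π.src.inv a)) = 0 ∨ π.p.degH a = 2) :
    f (π.src.root b) = f (π.src.root (π.src.inv b)) := by
  have key := fibre_pair (Finset.univ.filter fun h' => π.p.onH h' = π.p.onH a) π.p.degH
    π.p.degH_pos (π.degree_two_half _) _ (π.sum_diff hf _) a (by simp) ha
  rcases π.tgt.edge_eq_iff.1 hab with h | h
  · exact sub_eq_zero.1 (key b (by simp [h]))
  · have h5 := key (π.src.inv b) (by simp [← π.p.inv_onH, h, π.tgt.inv_inv])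
    rw [π.src.inv_inv] at h5
    exact (sub_eq_zero.1 h5).symm

theorem relConnected_iff_span (F : Set π.Eud) :
    π.RelConnected F ↔ Submodule.span ℚ (π.diffOn '' Fᶜ) = ⊤ := by
  have h1 : Submodule.span ℚ (π.diffOn '' Fᶜ) = ⊤ ↔
      (Submodule.span ℚ (π.diffOn '' Fᶜ)).dualCoannihilator = ⊥ := by
    constructor
    · intro h
      rw [h, Submodule.dualCoannihilator_top]
    · intro h
      rw [← Subspace.dualCoannihilator_dualAnnihilator_eq (W := Submodule.span ℚ (π.diffOn '' Fᶜ)),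
        h, Submodule.dualAnnihilator_bot]
  rw [h1, relConnected_iff, Submodule.eq_bot_iff]
  have hmem : ∀ f : π.oddFun, f ∈ (Submodule.span ℚ (π.diffOn '' Fᶜ)).dualCoannihilator ↔
      ∀ h', π.src.edge h' ∉ π.liftedEdges F →
        f.1 (π.src.root h') = f.1 (π.src.root (π.src.inv h')) := by
    intro f
    rw [← SetLike.mem_coe, Submodule.coe_dualCoannihilator_span]
    constructor
    · intro hf h' hh'
      by_cases hd : π.IsDilated (π.p.onE (π.src.edge h'))
      · obtain ⟨e', he', hdeg⟩ := hd
        obtain ⟨a, rfl⟩ := π.src.edge_surjective e'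
        exact π.diff_eq_zero f.2 a h' he' (Or.inr hdeg)
      · have h6 := hf (π.diffOn ⟨_, hd⟩) ⟨_, fun hF => hh' ⟨_, hF, rfl⟩, rfl⟩
        rw [diffOn_apply] at h6
        exact π.diff_eq_zero f.2 _ h' (π.exists_lift _).choose_spec (Or.inl h6)
    · rintro hf _ ⟨e, he, rfl⟩
      rw [diffOn_apply, sub_eq_zero]
      refine hf _ ?_
      rintro ⟨e₁, he₁, heq⟩
      rw [(π.exists_lift e.1).choose_spec] at heq
      exact he (Subtype.ext heq ▸ he₁)
  constructor
  · intro h f hf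
    exact Subtype.ext (h f.1 f.2 ((hmem f).1 hf))
  · intro h f hf hloc
    exact congrArg Subtype.val (h ⟨f, hf⟩ ((hmem ⟨f, hf⟩).2 hloc))

theorem span_compl_augment {ι W : Type*} [Finite ι] [AddCommGroup W] [Module ℚ W] (D : ι → W)
    {I J : Set ι} (hI : Submodule.span ℚ (D '' Iᶜ) = ⊤) (hJ : Submodule.span ℚ (D '' Jᶜ) = ⊤)
    (hlt : I.ncard < J.ncard) :
    ∃ e ∈ J, e ∉ I ∧ Submodule.span ℚ (D '' (insert e I)ᶜ) = ⊤ := by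
  have := Fintype.ofFinite ι
  obtain ⟨X, hXsub, -, hXspan, hXind⟩ := exists_linearIndepOn_extension
    (linearIndepOn_empty ℚ D) (Set.empty_subset (I ∪ J)ᶜ)
  obtain ⟨B, hBsub, hXB, hBspan, hBind⟩ := exists_linearIndepOn_extension hXind
    (hXsub.trans (Set.compl_subset_compl.2 Set.subset_union_left) : X ⊆ Iᶜ)
  have : Module.Finite ℚ W := Module.Finite.of_fg_top (by
    rw [← hI]
    exact Submodule.fg_span (Set.toFinite _))
  by_contra! hno
  have hJB : J \ I ⊆ B := by
    intro e he
    by_contra heB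
    refine hno e he.1 he.2 (top_le_iff.1 ?_)
    rw [← hI]
    refine (Submodule.span_le.2 hBspan).trans (Submodule.span_mono (Set.image_mono ?_))
    intro b hb hins
    rcases hins with rfl | hbI
    · exact heB hb
    · exact hBsub hb hbI
  have hdisj : Disjoint (J \ I) X := Set.disjoint_left.2 fun e he hX =>
    hXsub hX (Or.inr he.1)
  have h1 : (J \ I).ncard + X.ncard ≤ B.ncard := by
    rw [← Set.ncard_union_eq hdisj]
    exact Set.ncard_le_ncard (Set.union_subset hJB hXB)
  have h2 : B.ncard ≤ Module.finrank ℚ W := by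
    have := LinearIndependent.fintype_card_le_finrank hBind
    rwa [Set.ncard_eq_toFinset_card', Set.toFinset_card]
  have h3 : Submodule.span ℚ (D '' ((I \ J) ∪ X)) = ⊤ := by
    rw [eq_top_iff, ← hJ]
    refine Submodule.span_le.2 ?_
    rintro _ ⟨e, he, rfl⟩
    by_cases heI : e ∈ I
    · exact Submodule.subset_span ⟨e, Or.inl ⟨heI, he⟩, rfl⟩
    · exact Submodule.span_mono (Set.image_mono Set.subset_union_right)
        (hXspan ⟨e, fun h => h.elim heI he, rfl⟩)
  have h4 : Module.finrank ℚ W ≤ (I \ J).ncard + X.ncard := by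
    have h5 := finrank_span_le_card (R := ℚ) (D '' ((I \ J) ∪ X))
    rw [h3, finrank_top, ← Set.ncard_eq_toFinset_card'] at h5
    exact h5.trans ((Set.ncard_image_le).trans (Set.ncard_union_le _ _))
  have h6 := Set.ncard_inter_add_ncard_sdiff_eq_ncard J I
  have h7 := Set.ncard_inter_add_ncard_sdiff_eq_ncard I J
  rw [Set.inter_comm] at h7
  omega

/-- The signed cographic matroid `M^*` of a double cover, on the set of undilated edges: a set is
independent if the double cover stays relatively connected after its removal. -/
def cographicMatroid : Matroid π.Eud :=
  (IndepMatroid.ofFinite (E := Set.univ) Set.finite_univ π.RelConnected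
    π.relConnected_empty
    (by
      intro I J hJ hIJ
      rw [relConnected_iff_span] at hJ ⊢
      rw [eq_top_iff, ← hJ]
      exact Submodule.span_mono (Set.image_mono (Set.compl_subset_compl.2 hIJ)))
    (by
      intro I J hI hJ hlt
      simp only [relConnected_iff_span] at hI hJ ⊢
      exact span_compl_augment π.diffOn hI hJ hlt)
    (fun _ _ => Set.subset_univ _)).matroid

theorem cographicMatroid_indep (F : Set π.Eud) :
    π.cographicMatroid.Indep F ↔ π.RelConnected F := Iff.rfl

/-- The signed graphic matroid `M`, the dual of the signed cographic matroid. -/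
def graphicMatroid : Matroid π.Eud := π.cographicMatroid✶

/-- The index of a set `F` of undilated edges: the number of connected components of `G \ F`. -/
def index (F : Set π.Eud) : ℕ := Nat.card (π.tgt.delete (π.edges F)).ConnectedComponent

/-- An orientation of a double cover: an orientation of the target (which induces one of the
source), together with a labelling `ẽ⁺, ẽ⁻` of the two edges above each undilated edge `e`,
given by the choice of `ẽ⁺`. -/
structure Oriented where
  orientation : π.tgt.Orientation
  plus : π.Eud → π.src.E
  onE_plus : ∀ e, π.p.onE (plus e) = e.1

variable {π}

/-- `Ker p_* ⊆ H_1(G̃, ℤ)`. -/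
abbrev Oriented.kernel (o : π.Oriented) :
    Submodule ℤ (π.src.H1 (o.orientation.comap π.p.toHom)) :=
  LinearMap.ker (π.p.push o.orientation)

/-- `Ker p[C]_*` for a set `C` of undilated edges, viewed in `Ker p_*`: the cycles in the kernel
that are supported on the preimage of `C`. -/
def Oriented.kernelOn (o : π.Oriented) (C : Set π.Eud) : Submodule ℤ o.kernel where
  carrier := {γ | ∀ e', e' ∉ π.liftedEdges C → γ.1.1 e' = 0}
  zero_mem' := fun _ _ => rfl
  add_mem' := by
    intro a b ha hb e' he'
    simp [ha e' he', hb e' he']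
  smul_mem' := by
    intro c a ha e' he'
    simp [ha e' he']

/-- `γ` is a fundamental cycle `γ_C` of `C`: a generator of `Ker p[C]_*`. -/
def Oriented.IsFundamentalCycle (o : π.Oriented) (C : Set π.Eud) (γ : o.kernel) : Prop :=
  Submodule.span ℤ {γ} = o.kernelOn C

/-- The coefficient `γ(e)` of `ẽ⁺ - ẽ⁻` in an element `γ = ∑ γ(e) (ẽ⁺ - ẽ⁻)` of the kernel. -/
def Oriented.coeff (o : π.Oriented) (γ : o.kernel) (e : π.Eud) : ℤ := γ.1.1 (o.plus e)

/-- The oriented circuits of the oriented matroid on `M` induced by the orientation: the sign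
vectors of the fundamental cycles of the circuits of `M`. A signed subset of `E_ud` is encoded by
its sign function. -/
def Oriented.orientedCircuits (o : π.Oriented) : Set (π.Eud → SignType) :=
  {s | ∃ C, π.graphicMatroid.IsCircuit C ∧ ∃ γ, o.IsFundamentalCycle C γ ∧
    s = fun e => SignType.sign (o.coeff γ e)}

end DoubleCover

/-- Reorientation of a family of signed subsets along a set `A`: signs of elements of `A` flip. -/
def reorient {α : Type*} (A : Set α) (S : Set (α → SignType)) : Set (α → SignType) :=
  (fun s a => if a ∈ A then -s a else s a) '' S

/-- Transport of a family of signed subsets along a bijection of ground sets. -/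
def relabel {α β : Type*} (φ : α ≃ β) (S : Set (α → SignType)) : Set (β → SignType) :=
  (fun s => s ∘ φ.symm) '' S

/-- A double cover of metric graphs, given by a model: a double cover of graphs with positive edge
lengths for which the map dilates each edge by the local degree. -/
structure MetricDoubleCover extends DoubleCover.{u} where
  srcLen : src.E → ℝ
  tgtLen : tgt.E → ℝ
  srcLen_pos : ∀ e', 0 < srcLen e'
  tgtLen_pos : ∀ e, 0 < tgtLen e
  dilation : ∀ e', tgtLen (p.onE e') = p.degE e' * srcLen e'

namespace MetricDoubleCover

variable (π : MetricDoubleCover.{u}) (o : π.Oriented)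

/-- The norm homomorphism `Nm = (π^*, π_*) : Jac(Γ̃) → Jac(Γ)`. -/
def norm : IntegralTorus.Hom
    (π.src.jacobian (o.orientation.comap π.p.toHom) π.srcLen π.srcLen_pos)
    (π.tgt.jacobian o.orientation π.tgtLen π.tgtLen_pos) where
  pull := π.p.pull o.orientation
  push := π.p.push o.orientation
  adjoint := π.p.integrationPairing_pull o.orientation π.dilation

/-- The tropical Prym variety: the kernel torus of the norm homomorphism. -/
def prym : IntegralTorus.{u} := IntegralTorus.kernelTorus (π.norm o)

/-- The polarization of the Prym variety induced from the principal polarization of `Jac(Γ̃)`. -/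
def prymPolarization : (π.prym o).Polarization :=
  (π.src.jacobianPolarization _ π.srcLen π.srcLen_pos).induced
    (IntegralTorus.kernelIncl (π.norm o)) (Submodule.injective_subtype _)

/-- The principalized Prym variety. -/
def prymPrincipal : PPTAV.{u} := (π.prymPolarization o).principalized

/-- The edge lengths on the undilated edges of the target. -/
def len (e : π.Eud) : ℝ := π.tgtLen e.1

end MetricDoubleCover

end TropicalPrym

end

/-! An element of Ker p_* is determined by its coefficients γ(e), and in these coordinates the
polarization form is 2 ∑ γ(e) δ(e) ℓ(e) (`sum_coeff`). A pptav is determined by its lattice Λ' with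
this form (`PPTAV.Iso.ofPush`), so it suffices that φ, corrected by the signs of the reorientation,
carries one coefficient lattice onto the other.

The coefficient lattice is the group of integral relations between the vectors `vec e`, the
boundaries of ẽ⁺ - ẽ⁻ (`kernelEquiv`), and M^* is the dual of the matroid that these vectors
represent (`represents_cographicMatroid`). This lattice is saturated and rationally generated by the
γ_C (`Represents.mem_of_isFundamental`), so each γ_C need only be matched up to a scalar.

The signs of γ_C are given by the oriented matroid. For absolute values, take a base B of M^*
meeting C only in f and put B' = B - f + e. Then |γ_C(f)| : |γ_C(e)| is the ratio of the indices of
the lattices spanned by the vectors outside B and outside B' (`IsFundamental.ratio`).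

Up to a factor common to all bases these indices are 2^{ind(B)} (`hasIndex_cographicMatroid`).
Indeed, modulo pull-backs and boundaries of edges not above B, all vertices over one component of G
\ B become equal and of order two, and the quotient is (ℤ/2)^{ind(B)} (`index_divisors`). Passing to
anti-invariant divisors divides this by a factor independent of B (`divisors_inf_ker`). -/

noncomputable section

namespace TropicalPrym

universe u v

open scoped Classical

/-! ### Integral relations between lattice vectors indexed by the ground set of a matroid -/

namespace LatticeRelation

open Module

/-! ### Relations and lattice indices for one family of vectors. -/

section Relations

variable {E Y : Type*} [AddCommGroup Y] (d : E → Y)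

/-- The span of the vectors indexed by the complement of `F`. -/
def spanCompl (F : Set E) : Submodule ℤ Y := Submodule.span ℤ (d '' Fᶜ)

theorem spanCompl_anti {F F' : Set E} (h : F ⊆ F') : spanCompl d F' ≤ spanCompl d F :=
  Submodule.span_mono (Set.image_mono (Set.compl_subset_compl.2 h))

theorem mem_spanCompl_of_notMem {F : Set E} {e : E} (h : e ∉ F) : d e ∈ spanCompl d F :=
  Submodule.subset_span ⟨e, h, rfl⟩

theorem spanCompl_diff_singleton (B : Set E) (f : E) :
    spanCompl d (B \ {f}) = Submodule.span ℤ {d f} ⊔ spanCompl d B := by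
  rw [spanCompl, spanCompl, ← Submodule.span_union]
  congr 1
  ext y
  constructor
  · rintro ⟨e, he, rfl⟩
    by_cases hef : e = f
    · exact Or.inl (by simp [hef])
    · exact Or.inr ⟨e, fun hB => he ⟨hB, hef⟩, rfl⟩
  · rintro (hy | ⟨e, he, rfl⟩)
    · exact ⟨f, fun h => h.2 rfl, hy.symm⟩
    · exact ⟨e, fun h => he h.1, rfl⟩

/-- Adjoining `d f` to the lattice spanned outside `B` enlarges it by a cyclic quotient ℤ/kℤ. The
case k = 0 agrees with the convention that an infinite index is 0. -/
theorem index_spanCompl {B : Set E} {f : E} {k : ℤ}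
    (hk : ∀ n : ℤ, n • d f ∈ spanCompl d B ↔ k ∣ n) :
    (spanCompl d B).toAddSubgroup.index =
      k.natAbs * (spanCompl d (B \ {f})).toAddSubgroup.index := by
  rw [← AddSubgroup.relIndex_mul_index
    (show (spanCompl d B).toAddSubgroup ≤ (spanCompl d (B \ {f})).toAddSubgroup from
      spanCompl_anti d Set.sdiff_subset)]
  congr 1
  have h1 : (spanCompl d (B \ {f})).toAddSubgroup =
      (zmultiplesHom Y (d f)).range ⊔ (spanCompl d B).toAddSubgroup := by
    rw [spanCompl_diff_singleton d B f, Submodule.sup_toAddSubgroup]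
    congr 1
    ext y
    simp [Submodule.mem_span_singleton, AddSubgroup.mem_zmultiples_iff]
  rw [h1, AddSubgroup.relIndex_sup_right, ← AddSubgroup.index_comap, ← Int.index_zmultiples]
  congr 1
  ext n
  simp [hk, Int.mem_zmultiples_iff]

variable [Fintype E]

/-- The integral relations between the vectors `d e`. -/
def rel : Submodule ℤ (E → ℤ) := LinearMap.ker (Fintype.linearCombination ℤ d)

theorem mem_rel {x : E → ℤ} : x ∈ rel d ↔ ∑ e, x e • d e = 0 := by
  rw [rel, LinearMap.mem_ker, Fintype.linearCombination_apply]

/-- The integral relations supported on `C`. -/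
def relOn (C : Set E) : Submodule ℤ (E → ℤ) where
  carrier := {x | x ∈ rel d ∧ ∀ e, e ∉ C → x e = 0}
  zero_mem' := ⟨zero_mem _, fun _ _ => rfl⟩
  add_mem' := by
    rintro a b ⟨ha, ha'⟩ ⟨hb, hb'⟩
    exact ⟨add_mem ha hb, fun e he => by simp [ha' e he, hb' e he]⟩
  smul_mem' := by
    rintro c a ⟨ha, ha'⟩
    exact ⟨Submodule.smul_mem _ c ha, fun e he => by simp [ha' e he]⟩

theorem mem_relOn {C : Set E} {x : E → ℤ} :
    x ∈ relOn d C ↔ x ∈ rel d ∧ ∀ e, e ∉ C → x e = 0 := Iff.rfl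

theorem mem_spanCompl {F : Set E} {y : Y} :
    y ∈ spanCompl d F ↔ ∃ x : E → ℤ, (∀ e ∈ F, x e = 0) ∧ ∑ e, x e • d e = y := by
  constructor
  · intro h
    induction h using Submodule.span_induction with
    | mem y hy =>
      obtain ⟨e, he, rfl⟩ := hy
      refine ⟨Pi.single e 1, fun e' he' => ?_, ?_⟩
      · rw [Pi.single_eq_of_ne]
        rintro rfl
        exact he he'
      · rw [Finset.sum_eq_single e] <;> simp +contextual
    | zero => exact ⟨0, by simp, by simp⟩
    | add a b _ _ ha hb =>
      obtain ⟨x, hx, rfl⟩ := ha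
      obtain ⟨x', hx', rfl⟩ := hb
      exact ⟨x + x', fun e he => by simp [hx e he, hx' e he],
        by simp [add_smul, Finset.sum_add_distrib]⟩
    | smul c a _ ha =>
      obtain ⟨x, hx, rfl⟩ := ha
      exact ⟨c • x, fun e he => by simp [hx e he], by simp [mul_smul, Finset.smul_sum]⟩
  · rintro ⟨x, hx, rfl⟩
    refine Submodule.sum_mem _ fun e _ => ?_
    by_cases he : e ∈ F
    · simp [hx e he]
    · exact Submodule.smul_mem _ _ (Submodule.subset_span ⟨e, he, rfl⟩)

/-- Solve the relation for its `g`-term: the remaining terms involve only vectors outside `F` and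
different from `d g`. -/
theorem smul_mem_spanCompl {F : Set E} {x : E → ℤ} {g : E} (hx : x ∈ rel d)
    (hF : ∀ e ∈ F, x e = 0) : x g • d g ∈ spanCompl d (insert g F) := by
  rw [mem_spanCompl]
  refine ⟨Pi.single g (x g) - x, ?_, ?_⟩
  · rintro e (rfl | he)
    · simp
    · by_cases heg : e = g
      · subst heg
        simp
      · simp [heg, hF e he]
  · simp only [Pi.sub_apply, sub_smul, Finset.sum_sub_distrib, (mem_rel d).1 hx, sub_zero]
    rw [Finset.sum_eq_single g] <;> simp +contextual

theorem exists_mem_rel {B : Set E} {f : E} {n : ℤ} (h : n • d f ∈ spanCompl d B)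
    (hf : f ∈ B) : ∃ x ∈ rel d, x f = n ∧ ∀ e ∈ B, e ≠ f → x e = 0 := by
  obtain ⟨x, hx, hsum⟩ := (mem_spanCompl d).1 h
  refine ⟨Pi.single f n - x, ?_, by simp [hx f hf], fun e he hef => by simp [hx e he, hef]⟩
  rw [mem_rel]
  simp only [Pi.sub_apply, sub_smul, Finset.sum_sub_distrib, hsum]
  rw [Finset.sum_eq_single f] <;> simp +contextual

end Relations

/-! ### Relations of a represented matroid and their supports. -/

section Matroid

section Cocircuit

variable {E : Type*} {N : Matroid E}

/-- A cocircuit is a minimal set meeting every base, so some base misses C \ {f}, and that base can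
meet C only in f. -/
theorem exists_isBase_inter_eq {C : Set E} (hC : N.IsCocircuit C) {f : E} (hf : f ∈ C) :
    ∃ B, N.IsBase B ∧ f ∈ B ∧ ∀ e ∈ C, e ∈ B → e = f := by
  rw [Matroid.isCocircuit_iff_minimal, Set.minimal_iff_forall_ssubset] at hC
  obtain ⟨hC1, hC2⟩ := hC
  have h1 := hC2 (Set.sdiff_singleton_ssubset.2 hf)
  push Not at h1
  obtain ⟨B, hB, hBC⟩ := h1
  have key : ∀ e ∈ C, e ∈ B → e = f := fun e heC heB => by
    by_contra hef
    have h2 : e ∈ (C \ {f}) ∩ B := ⟨⟨heC, hef⟩, heB⟩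
    rw [hBC] at h2
    exact h2
  obtain ⟨e, heC, heB⟩ := hC1 B hB
  exact ⟨B, hB, key e heC heB ▸ heB, key⟩

theorem exists_mem_of_isBase {C : Set E} (hC : N.IsCocircuit C) {B : Set E} (hB : N.IsBase B) :
    ∃ e ∈ C, e ∈ B := by
  rw [Matroid.isCocircuit_iff_minimal] at hC
  obtain ⟨e, heC, heB⟩ := hC.1 B hB
  exact ⟨e, heC, heB⟩

theorem isBase_image {E₁ E₂ : Type*} {N₁ : Matroid E₁} {N₂ : Matroid E₂}
    (φ : E₁ ≃ E₂) (h : ∀ F, N₁.Indep F ↔ N₂.Indep (φ '' F)) {B : Set E₁}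
    (hB : N₁.IsBase B) : N₂.IsBase (φ '' B) := by
  rw [Matroid.isBase_iff_maximal_indep] at hB ⊢
  refine ⟨(h B).1 hB.prop, fun F hF hBF => ?_⟩
  have h1 : φ '' (φ.symm '' F) = F := by simp [Set.image_image]
  have h2 : N₁.Indep (φ.symm '' F) := by rwa [h, h1]
  have h3 := hB.le_of_ge h2 (by
    intro e he
    exact ⟨φ e, hBF ⟨e, he, rfl⟩, by simp⟩)
  rw [← h1]
  exact Set.image_mono h3

end Cocircuit

variable {E Y : Type*} [Fintype E] [AddCommGroup Y] {d : E → Y} {N : Matroid E}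

/-- The matroid `N` is the dual of the matroid represented by the vectors `d e`, which are
required to generate a subgroup of finite index: a set is independent in `N` if the vectors
outside of it still generate up to torsion. -/
structure Represents (N : Matroid E) (d : E → Y) : Prop where
  ground : N.E = Set.univ
  indep_iff : ∀ F : Set E, N.Indep F ↔ ∀ y : Y, ∃ n : ℤ, n ≠ 0 ∧ n • y ∈ spanCompl d F

/-- The relation expresses a nonzero multiple of `d g` through the other vectors outside `F`, so
dropping `d g` as well costs only torsion. -/
theorem Represents.insert_indep (h : Represents N d) {F : Set E} (hF : N.Indep F) {x : E → ℤ}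
    (hx : x ∈ rel d) (hxF : ∀ e ∈ F, x e = 0) {g : E} (hg : x g ≠ 0) : N.Indep (insert g F) := by
  rw [h.indep_iff]
  intro y
  obtain ⟨n, hn, hy⟩ := (h.indep_iff F).1 hF y
  refine ⟨x g * n, mul_ne_zero hg hn, ?_⟩
  obtain ⟨z, hz, hsum⟩ := (mem_spanCompl d).1 hy
  rw [mul_smul, ← hsum, Finset.smul_sum]
  refine Submodule.sum_mem _ fun e _ => ?_
  by_cases heF : e ∈ F
  · simp [hz e heF]
  by_cases heg : e = g
  · subst heg
    rw [smul_comm]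
    exact Submodule.smul_mem _ _ (smul_mem_spanCompl d hx hxF)
  · refine Submodule.smul_mem _ _ (Submodule.smul_mem _ _ (mem_spanCompl_of_notMem d ?_))
    rintro (h | h)
    exacts [heg h, heF h]

/-- A nonzero coordinate would allow the base to be enlarged. Hence the coordinates in a base
determine a relation. -/
theorem Represents.eq_zero (h : Represents N d) {B : Set E} (hB : N.IsBase B) {x : E → ℤ}
    (hx : x ∈ rel d) (hxB : ∀ e ∈ B, x e = 0) : x = 0 := by
  ext g
  by_contra hg
  have h1 := h.insert_indep hB.indep hx hxB hg
  exact hg (hxB g (hB.mem_of_insert_indep h1))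

/-- If x(g) ≠ 0 for some g outside C, then f can be exchanged for g in B, and the new base misses
the cocircuit C, which is impossible. -/
theorem Represents.mem_relOn (h : Represents N d) {C : Set E} (hC : N.IsCocircuit C) {f : E}
    {B : Set E} (hB : N.IsBase B) (hfB : f ∈ B) (hBC : ∀ e ∈ C, e ∈ B → e = f) {x : E → ℤ}
    (hx : x ∈ rel d) (hxB : ∀ e ∈ B, e ≠ f → x e = 0) (hfC : f ∈ C) : x ∈ relOn d C := by
  refine ⟨hx, fun g hg => ?_⟩
  by_contra hxg
  have hgf : g ≠ f := by
    rintro rfl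
    exact hg hfC
  have hgB : g ∉ B := fun h' => hxg (hxB g h' hgf)
  have h1 : N.Indep (insert g (B \ {f})) :=
    h.insert_indep (hB.indep.subset Set.sdiff_subset) hx (fun e he => hxB e he.1 he.2) hxg
  have h2 := hB.exchange_isBase_of_indep hgB h1
  obtain ⟨e, heC, he⟩ := exists_mem_of_isBase hC h2
  rcases he with rfl | he
  · exact hg heC
  · exact he.2 (hBC e heC he.1)

theorem Represents.exists_apply_ne_zero (h : Represents N d) {C : Set E} (hC : N.IsCocircuit C)
    {f : E} (hf : f ∈ C) : ∃ x ∈ relOn d C, x f ≠ 0 := by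
  obtain ⟨B, hB, hfB, hBC⟩ := exists_isBase_inter_eq hC hf
  obtain ⟨n, hn, hy⟩ := (h.indep_iff B).1 hB.indep (d f)
  obtain ⟨x, hx, hxf, hxB⟩ := exists_mem_rel d hy hfB
  exact ⟨x, h.mem_relOn hC hB hfB hBC hx hxB hf, by rwa [hxf]⟩

/-- A fundamental relation of `C`: a generator of the relations supported on `C`. -/
def IsFundamental (d : E → Y) (C : Set E) (c : E → ℤ) : Prop :=
  Submodule.span ℤ {c} = relOn d C

theorem IsFundamental.mem {C : Set E} {c : E → ℤ} (hc : IsFundamental d C c) : c ∈ relOn d C :=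
  hc ▸ Submodule.mem_span_singleton_self c

theorem IsFundamental.exists_eq_smul {C : Set E} {c x : E → ℤ} (hc : IsFundamental d C c)
    (hx : x ∈ relOn d C) : ∃ n : ℤ, n • c = x :=
  Submodule.mem_span_singleton.1 (hc.symm ▸ hx)

/-- With a base meeting C only in f, the f-coordinate is injective on the relations supported on C.
Its image is an ideal of ℤ, hence principal, and a preimage of the generator works. -/
theorem Represents.exists_isFundamental (h : Represents N d) {C : Set E}
    (hC : N.IsCocircuit C) : ∃ c, IsFundamental d C c := by
  obtain ⟨f, hf⟩ : C.Nonempty := hC.isCircuit.nonempty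
  obtain ⟨B, hB, hfB, hBC⟩ := exists_isBase_inter_eq hC hf
  obtain ⟨n, hn⟩ := (IsPrincipalIdealRing.principal
    ((relOn d C).map (LinearMap.proj f : (E → ℤ) →ₗ[ℤ] ℤ))).principal
  have hn' : n ∈ (relOn d C).map (LinearMap.proj f : (E → ℤ) →ₗ[ℤ] ℤ) :=
    hn ▸ Submodule.mem_span_singleton_self n
  obtain ⟨c, hc, rfl⟩ := hn'
  refine ⟨c, le_antisymm ((Submodule.span_singleton_le_iff_mem _ _).2 hc) fun x hx => ?_⟩
  have hx' : (LinearMap.proj f : (E → ℤ) →ₗ[ℤ] ℤ) x ∈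
      Submodule.span ℤ {(LinearMap.proj f : (E → ℤ) →ₗ[ℤ] ℤ) c} :=
    hn ▸ Submodule.mem_map_of_mem hx
  obtain ⟨k, hk⟩ := Submodule.mem_span_singleton.1 hx'
  refine Submodule.mem_span_singleton.2 ⟨k, ?_⟩
  have h0 := (relOn d C).sub_mem hx ((relOn d C).smul_mem k hc)
  refine (sub_eq_zero.1 (h.eq_zero hB h0.1 fun e he => ?_)).symm
  by_cases heC : e ∈ C
  · rw [hBC e heC he]
    simpa [sub_eq_zero] using hk.symm
  · exact h0.2 e heC

theorem IsFundamental.apply_ne_zero (h : Represents N d) {C : Set E} (hC : N.IsCocircuit C)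
    {c : E → ℤ} (hc : IsFundamental d C c) (e : E) : c e ≠ 0 ↔ e ∈ C := by
  constructor
  · intro he
    by_contra heC
    exact he (hc.mem.2 e heC)
  · intro heC h0
    obtain ⟨x, hx, hxe⟩ := h.exists_apply_ne_zero hC heC
    obtain ⟨n, rfl⟩ := hc.exists_eq_smul hx
    exact hxe (by simp [h0])

/-- The multiples of `d f` in the lattice spanned outside B correspond to relations supported on C,
so c(f) generates the ideal needed in `index_spanCompl`. -/
theorem IsFundamental.index_eq (h : Represents N d) {C : Set E} (hC : N.IsCocircuit C)
    {c : E → ℤ} (hc : IsFundamental d C c) {B : Set E} (hB : N.IsBase B) {f : E} (hf : f ∈ C)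
    (hfB : f ∈ B) (hBC : ∀ e ∈ C, e ∈ B → e = f) :
    (spanCompl d B).toAddSubgroup.index =
      (c f).natAbs * (spanCompl d (B \ {f})).toAddSubgroup.index := by
  refine index_spanCompl d fun n => ⟨fun hn => ?_, ?_⟩
  · obtain ⟨x, hx, rfl, hxB⟩ := exists_mem_rel d hn hfB
    obtain ⟨k, rfl⟩ := hc.exists_eq_smul (h.mem_relOn hC hB hfB hBC hx hxB hf)
    exact ⟨k, by simp [mul_comm]⟩
  · rintro ⟨k, rfl⟩
    rw [mul_comm, mul_smul]
    refine Submodule.smul_mem _ _ ?_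
    have h1 := smul_mem_spanCompl d (F := B \ {f}) (g := f) hc.mem.1 fun e he =>
      hc.mem.2 e fun heC => he.2 (hBC e heC he.1)
    rwa [Set.insert_sdiff_singleton, Set.insert_eq_of_mem hfB] at h1

/-- The indices of the lattices spanned by complements of bases are powers of two, up to a common
factor. -/
def HasIndex (N : Matroid E) (d : E → Y) (ind : Set E → ℕ) : Prop :=
  ∃ κ : ℕ, ∀ B, N.IsBase B → (spanCompl d B).toAddSubgroup.index * κ = 2 ^ ind B

/-- The bases B and B' = B - f + e share the set B \ {f} = B' \ {e}. Comparing both lattices with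
the one spanned outside this set gives factors |c(f)| and |c(e)|, and cross-multiplying removes any
division. -/
theorem IsFundamental.ratio (h : Represents N d) {ind : Set E → ℕ} (hind : HasIndex N d ind)
    {C : Set E} (hC : N.IsCocircuit C) {c : E → ℤ} (hc : IsFundamental d C c) {B : Set E}
    (hB : N.IsBase B) {e f : E} (he : e ∈ C) (hf : f ∈ C) (hef : e ≠ f) (hfB : f ∈ B)
    (hBC : ∀ e ∈ C, e ∈ B → e = f) :
    N.IsBase (insert e (B \ {f})) ∧
      (c f).natAbs * 2 ^ ind (insert e (B \ {f})) = (c e).natAbs * 2 ^ ind B := by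
  have heB : e ∉ B := fun h' => hef (hBC e he h')
  have h1 : N.Indep (insert e (B \ {f})) :=
    h.insert_indep (hB.indep.subset Set.sdiff_subset) hc.mem.1
      (fun g hg => hc.mem.2 g fun hgC => hg.2 (hBC g hgC hg.1))
      ((hc.apply_ne_zero h hC e).2 he)
  have hB' := hB.exchange_isBase_of_indep heB h1
  refine ⟨hB', ?_⟩
  obtain ⟨κ, hκ⟩ := hind
  rw [← hκ _ hB, ← hκ _ hB', hc.index_eq h hC hB hf hfB hBC, hc.index_eq h hC hB' he
    (Set.mem_insert _ _)]
  · have : insert e (B \ {f}) \ {e} = B \ {f} := by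
      ext g
      constructor
      · rintro ⟨rfl | hg, hg'⟩
        exacts [absurd rfl hg', hg]
      · intro hg
        exact ⟨Or.inr hg, fun h' => heB (h' ▸ hg.1)⟩
    rw [this]
    ring
  · rintro g hgC (rfl | hg)
    · rfl
    · exact absurd (hBC g hgC hg.1) hg.2

/-- Every relation has a multiple in a subgroup that is saturated in the relations and contains
all fundamental relations. -/
theorem Represents.mem_of_isFundamental (h : Represents N d) {P : Submodule ℤ (E → ℤ)}
    (hP : ∀ C c, N.IsCocircuit C → IsFundamental d C c → c ∈ P)
    (hsat : ∀ (n : ℤ) x, n ≠ 0 → n • x ∈ P → x ∈ P) (x : E → ℤ) (hx : x ∈ rel d) : x ∈ P := by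
  induction hn : (Function.support x).ncard using Nat.strong_induction_on generalizing x with
  | _ n ih =>
    by_cases hx0 : x = 0
    · rw [hx0]
      exact zero_mem P
    -- Otherwise the support is coindependent, hence disjoint from a base, and x = 0 by `eq_zero`.
    obtain ⟨C, hCx, hC⟩ : ∃ C ⊆ Function.support x, N.IsCocircuit C := by
      by_contra! hno
      have hcoind : N✶.Indep (Function.support x) := by
        rw [Matroid.indep_iff_forall_subset_not_isCircuit (by simp [h.ground])]
        exact hno
      obtain ⟨B, hB, hBx⟩ := Matroid.dual_indep_iff_exists'.1 hcoind |>.2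
      refine hx0 (h.eq_zero hB hx fun e he => ?_)
      by_contra hxe
      exact Set.disjoint_left.1 hBx hxe he
    obtain ⟨c, hc⟩ := h.exists_isFundamental hC
    obtain ⟨f, hf⟩ : C.Nonempty := hC.isCircuit.nonempty
    refine hsat (c f) x ((hc.apply_ne_zero h hC f).2 hf) ?_
    -- This combination vanishes at f and outside the support of x, so its support is strictly
    -- smaller. Saturation of P then removes the factor c(f).
    have h1 : c f • x - x f • c ∈ P := by
      refine ih _ ?_ _ (sub_mem (Submodule.smul_mem _ _ hx) (Submodule.smul_mem _ _ hc.mem.1)) rfl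
      rw [← hn]
      refine Set.ncard_lt_ncard ⟨fun e he => ?_, fun hle => ?_⟩
      · by_contra hxe
        have hxe' : x e = 0 := by simpa using hxe
        refine he ?_
        have : c e = 0 := by
          by_contra hce
          exact hxe (hCx ((hc.apply_ne_zero h hC e).1 hce))
        simp [hxe', this]
      · refine hle (hCx hf) ?_
        simp [mul_comm]
    simpa using add_mem h1 (P.smul_mem (x f) (hP C c hC hc))

end Matroid

/-! ### Comparison of the relation lattices of two represented matroids. -/

section Comparison

variable {E₁ E₂ Y₁ Y₂ : Type*} [Fintype E₁] [Fintype E₂] [AddCommGroup Y₁] [AddCommGroup Y₂]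
  {d₁ : E₁ → Y₁} {d₂ : E₂ → Y₂} {N₁ : Matroid E₁} {N₂ : Matroid E₂}

/-- The signed permutation of coordinates given by a bijection and a choice of signs. -/
def signedRelabel {E₁ E₂ : Type*} (φ : E₁ ≃ E₂) (a : E₂ → ℤˣ) : (E₁ → ℤ) →ₗ[ℤ] (E₂ → ℤ) where
  toFun x e := a e * x (φ.symm e)
  map_add' x y := by
    ext e
    simp [mul_add]
  map_smul' c x := by
    ext e
    simp [mul_left_comm]

theorem signedRelabel_apply {E₁ E₂ : Type*} (φ : E₁ ≃ E₂) (a : E₂ → ℤˣ) (x : E₁ → ℤ) (e : E₂) :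
    signedRelabel φ a x e = a e * x (φ.symm e) := rfl

theorem eq_of_sign_eq {m n : ℤ} (hs : SignType.sign m = SignType.sign n)
    (ha : m.natAbs = n.natAbs) : m = n := by
  rw [← sign_mul_abs m, ← sign_mul_abs n, hs, Int.abs_eq_natAbs, Int.abs_eq_natAbs, ha]

/-- Signs and index ratios determine a fundamental relation up to a scalar, so the image of each one
is proportional to a fundamental relation on the other side. Torsion-freeness of `Y₂` makes the
target lattice saturated, so proportionality is enough. -/
theorem signedRelabel_mem_rel [Module.IsTorsionFree ℤ Y₂]
    (h₁ : Represents N₁ d₁) (h₂ : Represents N₂ d₂) (φ : E₁ ≃ E₂)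
    (hindep : ∀ F, N₁.Indep F ↔ N₂.Indep (φ '' F)) {ind₁ : Set E₁ → ℕ} {ind₂ : Set E₂ → ℕ}
    (hi₁ : HasIndex N₁ d₁ ind₁) (hi₂ : HasIndex N₂ d₂ ind₂)
    (hind : ∀ F, N₁.Indep F → ind₂ (φ '' F) = ind₁ F) (a : E₂ → ℤˣ)
    (hsign : ∀ C c, N₁.IsCocircuit C → IsFundamental d₁ C c →
      ∃ C' c', N₂.IsCocircuit C' ∧ IsFundamental d₂ C' c' ∧
        ∀ e, SignType.sign (c' e) = SignType.sign (signedRelabel φ a c e))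
    {x : E₁ → ℤ} (hx : x ∈ rel d₁) : signedRelabel φ a x ∈ rel d₂ := by
  have hsat : ∀ (n : ℤ) z, n ≠ 0 → n • z ∈ rel d₂ → z ∈ rel d₂ := by
    intro n z hn hz
    rw [rel, LinearMap.mem_ker, map_smul] at hz
    exact (smul_eq_zero.1 hz).resolve_left hn
  refine h₁.mem_of_isFundamental (P := (rel d₂).comap (signedRelabel φ a)) ?_ ?_ x hx
  · intro C c hC hc
    obtain ⟨C', c', hC', hc', hs⟩ := hsign C c hC hc
    obtain ⟨f, hf⟩ : C.Nonempty := hC.isCircuit.nonempty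
    obtain ⟨B, hB, hfB, hBC⟩ := exists_isBase_inter_eq hC hf
    have hne : ∀ e, c' e ≠ 0 ↔ signedRelabel φ a c e ≠ 0 := fun e => by
      rw [← sign_ne_zero, hs, sign_ne_zero]
    have hmem : ∀ e, φ e ∈ C' ↔ e ∈ C := fun e => by
      rw [← hc'.apply_ne_zero h₂ hC', ← hc.apply_ne_zero h₁ hC, hne, signedRelabel_apply]
      simp
    have hB' := isBase_image φ hindep hB
    -- Proportionality is checked one coordinate at a time, with f as reference. Signs match by
    -- hypothesis, and absolute values match by the two instances of `IsFundamental.ratio`.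
    have hprop : c' (φ f) • signedRelabel φ a c = signedRelabel φ a c (φ f) • c' := by
      ext e'
      obtain ⟨e, rfl⟩ := φ.surjective e'
      simp only [Pi.smul_apply, smul_eq_mul]
      by_cases heC : e ∈ C
      swap
      · have h1 : c' (φ e) = 0 := hc'.mem.2 _ fun h => heC ((hmem e).1 h)
        rw [h1, not_not.1 fun h => (hne (φ e)).2 h h1, mul_zero, mul_zero]
      by_cases hef : e = f
      · subst hef
        ring
      refine eq_of_sign_eq ?_ ?_
      · rw [sign_mul, sign_mul, hs, hs]
      obtain ⟨hB₂, hr₁⟩ := hc.ratio h₁ hi₁ hC hB heC hf hef hfB hBC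
      obtain ⟨-, hr₂⟩ := hc'.ratio h₂ hi₂ hC' hB' ((hmem e).2 heC) ((hmem f).2 hf)
        (φ.injective.ne hef) ⟨f, hfB, rfl⟩ (by
          rintro _ hg ⟨g, hgB, rfl⟩
          rw [hBC g ((hmem g).1 hg) hgB])
      have himg : insert (φ e) (φ '' B \ {φ f}) = φ '' insert e (B \ {f}) := by
        rw [Set.image_insert_eq, Set.image_sdiff φ.injective, Set.image_singleton]
      rw [himg, hind _ hB₂.indep, hind _ hB.indep] at hr₂
      simp only [signedRelabel_apply, Equiv.symm_apply_apply, Int.natAbs_mul,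
        Int.units_natAbs, one_mul]
      -- Multiplying by both powers of two lets the two ratio identities be combined within ℕ.
      have hpos : 0 < 2 ^ ind₁ B * 2 ^ ind₁ (insert e (B \ {f})) := by positivity
      refine Nat.eq_of_mul_eq_mul_right hpos ?_
      calc (c' (φ f)).natAbs * (c e).natAbs * (2 ^ ind₁ B * 2 ^ ind₁ (insert e (B \ {f})))
          = ((c' (φ f)).natAbs * 2 ^ ind₁ (insert e (B \ {f}))) * ((c e).natAbs * 2 ^ ind₁ B) := by
            ring
        _ = _ := by rw [hr₂, ← hr₁]; ring
    refine hsat (c' (φ f)) _ ((hc'.apply_ne_zero h₂ hC' _).2 ((hmem f).2 hf)) ?_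
    rw [hprop]
    exact Submodule.smul_mem _ _ hc'.mem.1
  · intro n z hn hz
    refine hsat n _ hn ?_
    rw [← map_smul]
    exact hz

end Comparison

end LatticeRelation

/-! ### Chains on graphs and harmonic morphisms -/

namespace HGraph

/-- The boundary of 1-chains, with half-edges weighted by the orientation. -/
def boundary (G : HGraph.{u}) (o : G.Orientation) : (G.E → ℤ) →ₗ[ℤ] (G.V → ℤ) where
  toFun γ v := ∑ h : G.H with G.root h = v, (o.sign h : ℤ) * γ (G.edge h)
  map_add' a b := by
    ext v
    simp [mul_add, Finset.sum_add_distrib]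
  map_smul' c a := by
    ext v
    simp [Finset.mul_sum, mul_left_comm]

theorem boundary_apply (G : HGraph.{u}) (o : G.Orientation) (γ : G.E → ℤ) (v : G.V) :
    G.boundary o γ v = ∑ h : G.H with G.root h = v, (o.sign h : ℤ) * γ (G.edge h) := rfl

theorem mem_H1_iff_boundary {G : HGraph.{u}} {o : G.Orientation} {γ : G.E → ℤ} :
    γ ∈ G.H1 o ↔ G.boundary o γ = 0 := by
  rw [mem_H1, funext_iff]
  rfl

/-- Only the two half-edges of the edge contribute, with opposite signs. They are distinct even for
a loop, where the two terms cancel. -/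
theorem boundary_single (G : HGraph.{u}) (o : G.Orientation) (h : G.H) :
    G.boundary o (Pi.single (G.edge h) 1) =
      (o.sign h : ℤ) • (Pi.single (G.root h) 1 - Pi.single (G.root (G.inv h)) 1) := by
  ext v
  rw [boundary_apply, Finset.sum_filter, ← Finset.sum_subset (Finset.subset_univ {h, G.inv h}),
    Finset.sum_pair (G.inv_ne h).symm]
  · simp only [edge_inv, Pi.single_eq_same, o.sign_inv, Pi.smul_apply, Pi.sub_apply, smul_eq_mul,
      Pi.single_apply, eq_comm (a := v)]
    split_ifs <;> simp
  · intro h' _ hh'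
    have : G.edge h' ≠ G.edge h := by
      intro he
      have := G.edge_eq_iff.1 he.symm
      simp [this] at hh'
    simp [this]

theorem chain_eq_sum {α : Type*} [Fintype α] (c : α → ℤ) :
    c = ∑ a, c a • (Pi.single a 1 : α → ℤ) := by
  ext b
  simp [Finset.sum_apply, Pi.single_apply]

namespace Harmonic

variable {G' G : HGraph.{u}} (p : Harmonic G' G)

/-- Push-forward of 1-chains. -/
def pushE : (G'.E → ℤ) →ₗ[ℤ] (G.E → ℤ) where
  toFun c e := ∑ e' : G'.E with p.onE e' = e, c e'
  map_add' a b := by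
    ext e
    simp [Finset.sum_add_distrib]
  map_smul' c a := by
    ext e
    simp [Finset.mul_sum]

/-- Pull-back of 1-chains. -/
def pullE : (G.E → ℤ) →ₗ[ℤ] (G'.E → ℤ) where
  toFun b e' := p.degE e' * b (p.onE e')
  map_add' a b := by
    ext e
    simp [mul_add]
  map_smul' c a := by
    ext e
    simp [mul_left_comm]

/-- Push-forward of divisors. -/
def pushV : (G'.V → ℤ) →ₗ[ℤ] (G.V → ℤ) where
  toFun x v := ∑ v' : G'.V with p.onV v' = v, x v'
  map_add' a b := by
    ext e
    simp [Finset.sum_add_distrib]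
  map_smul' c a := by
    ext e
    simp [Finset.mul_sum]

/-- Pull-back of divisors. -/
def pullV : (G.V → ℤ) →ₗ[ℤ] (G'.V → ℤ) where
  toFun k v' := p.degV v' * k (p.onV v')
  map_add' a b := by
    ext e
    simp [mul_add]
  map_smul' c a := by
    ext e
    simp [mul_left_comm]

theorem pushE_apply (c : G'.E → ℤ) (e : G.E) :
    p.pushE c e = ∑ e' : G'.E with p.onE e' = e, c e' := rfl

theorem pullE_apply (b : G.E → ℤ) (e' : G'.E) : p.pullE b e' = p.degE e' * b (p.onE e') := rfl

theorem pushV_apply (x : G'.V → ℤ) (v : G.V) :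
    p.pushV x v = ∑ v' : G'.V with p.onV v' = v, x v' := rfl

theorem pullV_apply (k : G.V → ℤ) (v' : G'.V) : p.pullV k v' = p.degV v' * k (p.onV v') := rfl

theorem pushE_single (e' : G'.E) : p.pushE (Pi.single e' 1) = Pi.single (p.onE e') 1 := by
  ext e
  simp [pushE_apply, Pi.single_apply, eq_comm (a := e)]

theorem pushV_single (v' : G'.V) : p.pushV (Pi.single v' 1) = Pi.single (p.onV v') 1 := by
  ext e
  rw [pushV_apply, Finset.sum_filter, Finset.sum_eq_single v']
  · simp [Pi.single_apply, eq_comm (a := e)]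
  · intro b _ hb
    simp [hb]
  · simp

theorem pushV_boundary (o : G.Orientation) (c : G'.E → ℤ) :
    p.pushV (G'.boundary (o.comap p.toHom) c) = G.boundary o (p.pushE c) := by
  rw [chain_eq_sum c]
  simp only [map_sum, map_smul]
  refine Finset.sum_congr rfl fun e' _ => ?_
  obtain ⟨h, rfl⟩ := G'.edge_surjective e'
  rw [pushE_single, boundary_single, Hom.onE_edge, boundary_single, map_smul, map_sub,
    pushV_single, pushV_single, ← p.root_onH, ← p.root_onH, ← p.inv_onH]
  rfl

/-- This is where harmonicity enters: the local degrees of the half-edges at v' above a given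
half-edge sum to the degree of v'. -/
theorem boundary_pullE (o : G.Orientation) (b : G.E → ℤ) :
    G'.boundary (o.comap p.toHom) (p.pullE b) = p.pullV (G.boundary o b) := by
  ext v'
  have h := Finset.sum_fiberwise_of_maps_to
    (s := Finset.univ.filter fun h' : G'.H => G'.root h' = v')
    (t := Finset.univ.filter fun h : G.H => G.root h = p.onV v') (g := p.onH)
    (f := fun h' => (o.sign (p.onH h') : ℤ) *
      ((p.degH h' : ℤ) * b (G.edge (p.onH h')))) (by
      intro h' hh'
      rw [Finset.mem_filter] at hh' ⊢
      exact ⟨Finset.mem_univ _, by rw [p.root_onH, hh'.2]⟩)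
  refine h.symm.trans ?_
  rw [pullV_apply, boundary_apply, Finset.mul_sum]
  refine Finset.sum_congr rfl fun h hh => ?_
  rw [p.balanced v' h (Finset.mem_filter.1 hh).2, Nat.cast_sum, Finset.sum_mul,
    Finset.filter_filter]
  refine Finset.sum_congr rfl fun h' hh' => ?_
  rw [(Finset.mem_filter.1 hh').2.2]
  ring

end Harmonic

end HGraph

/-! ### Anti-invariant chains of a double cover -/

namespace DoubleCover

open LatticeRelation

variable (π : DoubleCover.{u})

theorem sum_degE (e : π.tgt.E) : ∑ e' : π.src.E with π.p.onE e' = e, π.p.degE e' = 2 := by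
  obtain ⟨h, rfl⟩ := π.tgt.edge_surjective e
  rw [← π.p.sum_edge_fiber π.p.degE, ← π.degree_two_half h]
  rfl

theorem degE_pos (e' : π.src.E) : 0 < π.p.degE e' := by
  obtain ⟨h, rfl⟩ := π.src.edge_surjective e'
  exact π.p.degH_pos h

theorem onV_surjective : Function.Surjective π.p.onV := by
  intro v
  by_contra! hne
  have h2 := π.degree_two v
  rw [Finset.filter_eq_empty_iff.2, Finset.sum_empty] at h2
  · omega
  · exact fun v' _ => hne v'

theorem pushV_pullV (k : π.tgt.V → ℤ) : π.p.pushV (π.p.pullV k) = (2 : ℤ) • k := by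
  ext v
  have h : ∀ v' ∈ Finset.univ.filter (fun v' => π.p.onV v' = v),
      π.p.pullV k v' = π.p.degV v' * k v := by
    intro v' hv'
    rw [HGraph.Harmonic.pullV_apply, (Finset.mem_filter.1 hv').2]
  rw [HGraph.Harmonic.pushV_apply, Finset.sum_congr rfl h, ← Finset.sum_mul, ← Nat.cast_sum,
    π.degree_two]
  simp

theorem pushE_pullE (b : π.tgt.E → ℤ) : π.p.pushE (π.p.pullE b) = (2 : ℤ) • b := by
  ext e
  have h : ∀ e' ∈ Finset.univ.filter (fun e' => π.p.onE e' = e),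
      π.p.pullE b e' = π.p.degE e' * b e := by
    intro e' he'
    rw [HGraph.Harmonic.pullE_apply, (Finset.mem_filter.1 he').2]
  rw [HGraph.Harmonic.pushE_apply, Finset.sum_congr rfl h, ← Finset.sum_mul, ← Nat.cast_sum,
    π.sum_degE]
  simp

/-- The anti-invariant part (doubled) of a divisor. -/
def antiV : (π.src.V → ℤ) →ₗ[ℤ] (π.src.V → ℤ) := (2 : ℤ) • LinearMap.id - π.p.pullV ∘ₗ π.p.pushV

/-- The anti-invariant part (doubled) of a 1-chain. -/
def antiE : (π.src.E → ℤ) →ₗ[ℤ] (π.src.E → ℤ) := (2 : ℤ) • LinearMap.id - π.p.pullE ∘ₗ π.p.pushE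

theorem antiV_apply (x : π.src.V → ℤ) : π.antiV x = (2 : ℤ) • x - π.p.pullV (π.p.pushV x) := rfl

theorem antiE_apply (c : π.src.E → ℤ) : π.antiE c = (2 : ℤ) • c - π.p.pullE (π.p.pushE c) := rfl

theorem antiV_pullV (k : π.tgt.V → ℤ) : π.antiV (π.p.pullV k) = 0 := by
  rw [antiV_apply, pushV_pullV, map_smul, sub_self]

theorem antiE_pullE (b : π.tgt.E → ℤ) : π.antiE (π.p.pullE b) = 0 := by
  rw [antiE_apply, pushE_pullE, map_smul, sub_self]

theorem pushE_antiE (c : π.src.E → ℤ) : π.p.pushE (π.antiE c) = 0 := by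
  rw [antiE_apply, map_sub, pushE_pullE, map_smul, sub_self]

theorem boundary_antiE (o : π.tgt.Orientation) (c : π.src.E → ℤ) :
    π.src.boundary (o.comap π.p.toHom) (π.antiE c) =
      π.antiV (π.src.boundary (o.comap π.p.toHom) c) := by
  rw [antiE_apply, antiV_apply, map_sub, map_smul, HGraph.Harmonic.boundary_pullE,
    HGraph.Harmonic.pushV_boundary]

/-- The positive degrees over an edge sum to two, so an edge of degree two is alone in its fibre.
Dilated edges therefore vanish in the anti-invariant part. -/
theorem two_smul_single {e' : π.src.E} (h : π.IsDilated (π.p.onE e')) :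
    (2 : ℤ) • (Pi.single e' 1 : π.src.E → ℤ) = π.p.pullE (Pi.single (π.p.onE e') 1) := by
  obtain ⟨e₀, he₀, hdeg⟩ := h
  have hmem : e₀ ∈ Finset.univ.filter (fun a => π.p.onE a = π.p.onE e') := by simp [he₀]
  have huniq : ∀ a, π.p.onE a = π.p.onE e' → a = e₀ := by
    intro a ha
    by_contra hne
    have h1 := π.sum_degE (π.p.onE e')
    rw [← Finset.add_sum_erase _ _ hmem, hdeg] at h1
    have h2 := Finset.single_le_sum (f := π.p.degE) (fun _ _ => Nat.zero_le _)
      (Finset.mem_erase.2 ⟨hne, by simp [ha]⟩ :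
        a ∈ (Finset.univ.filter (fun a => π.p.onE a = π.p.onE e')).erase e₀)
    have := π.degE_pos a
    omega
  have he' := huniq e' rfl
  subst he'
  ext a
  rw [HGraph.Harmonic.pullE_apply]
  by_cases ha : a = e'
  · subst ha
    simp [hdeg]
  · have : π.p.onE a ≠ π.p.onE e' := fun h => ha (huniq a h)
    simp [ha, this]

theorem apply_eq_zero_of_push_eq_zero {c : π.src.E → ℤ} (hc : π.p.pushE c = 0) {e' : π.src.E}
    (h : π.IsDilated (π.p.onE e')) : c e' = 0 := by
  have huniq : ∀ a, π.p.onE a = π.p.onE e' → a = e' := by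
    intro a ha
    have h1 := congrFun (π.two_smul_single h) a
    by_contra hne
    have h2 := π.degE_pos a
    simp [HGraph.Harmonic.pullE_apply, ha, hne] at h1
    omega
  have h1 := congrFun hc (π.p.onE e')
  rw [HGraph.Harmonic.pushE_apply, Finset.sum_eq_single e'] at h1
  · exact h1
  · intro b hb hbe
    exact absurd (huniq b (Finset.mem_filter.1 hb).2) hbe
  · simp

variable {π}

/-! ### Coordinates on Ker p_* given by a labelling. -/

namespace Oriented

variable (o : π.Oriented)

/-- Positive degrees summing to two, none equal to two, leave exactly two edges of degree one. -/
theorem exists_minus (g : π.Eud) : ∃ m, m ≠ o.plus g ∧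
    Finset.univ.filter (fun e' => π.p.onE e' = g.1) = {o.plus g, m} ∧
    π.p.degE (o.plus g) = 1 ∧ π.p.degE m = 1 := by
  have hmem : o.plus g ∈ Finset.univ.filter (fun e' => π.p.onE e' = g.1) := by
    simp [o.onE_plus]
  have h1 := π.sum_degE g.1
  have h2 : ∀ e', π.p.onE e' = g.1 → π.p.degE e' ≠ 2 := fun e' he' h => g.2 ⟨e', he', h⟩
  have h3 := h2 _ (o.onE_plus g)
  have h4 := π.degE_pos (o.plus g)
  rw [← Finset.add_sum_erase _ _ hmem] at h1
  set s := (Finset.univ.filter (fun e' => π.p.onE e' = g.1)).erase (o.plus g) with hs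
  have hne : s.Nonempty := by
    rw [Finset.nonempty_iff_ne_empty]
    intro h
    rw [h, Finset.sum_empty] at h1
    omega
  obtain ⟨m, hm⟩ := hne
  have h5 := π.degE_pos m
  have h6 := Finset.single_le_sum (f := π.p.degE) (fun _ _ => Nat.zero_le _) hm
  have h7 : s = {m} := by
    refine Finset.eq_singleton_iff_unique_mem.2 ⟨hm, fun a ha => ?_⟩
    by_contra ham
    have h8 := Finset.add_sum_erase s π.p.degE hm
    have h9 := Finset.single_le_sum (f := π.p.degE) (fun _ _ => Nat.zero_le _)
      (Finset.mem_erase.2 ⟨ham, ha⟩)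
    have := π.degE_pos a
    omega
  refine ⟨m, (Finset.mem_erase.1 hm).1, ?_, by omega, by omega⟩
  rw [← h7, hs, Finset.insert_erase hmem]

/-- The edge `ẽ⁻`. -/
def minus (g : π.Eud) : π.src.E := (o.exists_minus g).choose

theorem minus_ne_plus (g : π.Eud) : o.minus g ≠ o.plus g := (o.exists_minus g).choose_spec.1

theorem filter_onE (g : π.Eud) :
    Finset.univ.filter (fun e' => π.p.onE e' = g.1) = {o.plus g, o.minus g} :=
  (o.exists_minus g).choose_spec.2.1

theorem degE_plus (g : π.Eud) : π.p.degE (o.plus g) = 1 := (o.exists_minus g).choose_spec.2.2.1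

theorem degE_minus (g : π.Eud) : π.p.degE (o.minus g) = 1 := (o.exists_minus g).choose_spec.2.2.2

theorem onE_eq_iff (g : π.Eud) (e' : π.src.E) :
    π.p.onE e' = g.1 ↔ e' = o.plus g ∨ e' = o.minus g := by
  have := Finset.ext_iff.1 (o.filter_onE g) e'
  simpa using this

theorem onE_minus (g : π.Eud) : π.p.onE (o.minus g) = g.1 := (o.onE_eq_iff g _).2 (Or.inr rfl)

theorem plus_injective : Function.Injective o.plus := fun a b h =>
  Subtype.ext (by rw [← o.onE_plus a, h, o.onE_plus])

theorem minus_ne_plus' (g g' : π.Eud) : o.minus g ≠ o.plus g' := by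
  intro h
  have h1 : g = g' := Subtype.ext (by rw [← o.onE_minus g, h, o.onE_plus])
  subst h1
  exact o.minus_ne_plus g h

theorem pushE_apply (c : π.src.E → ℤ) (g : π.Eud) :
    π.p.pushE c g.1 = c (o.plus g) + c (o.minus g) := by
  rw [HGraph.Harmonic.pushE_apply, o.filter_onE, Finset.sum_pair (o.minus_ne_plus g).symm]

theorem antiE_plus (c : π.src.E → ℤ) (g : π.Eud) :
    π.antiE c (o.plus g) = c (o.plus g) - c (o.minus g) := by
  rw [antiE_apply, Pi.sub_apply, HGraph.Harmonic.pullE_apply, o.onE_plus, o.pushE_apply,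
    o.degE_plus]
  simp
  ring

/-- A source edge is above a dilated edge, or equals `ẽ⁺` or `ẽ⁻`. -/
theorem edge_cases (e' : π.src.E) : π.IsDilated (π.p.onE e') ∨
    ∃ g : π.Eud, π.p.onE e' = g.1 ∧ (e' = o.plus g ∨ e' = o.minus g) := by
  by_cases h : π.IsDilated (π.p.onE e')
  · exact Or.inl h
  · exact Or.inr ⟨⟨_, h⟩, rfl, (o.onE_eq_iff ⟨_, h⟩ e').1 rfl⟩

theorem single_plus_add_single_minus (g : π.Eud) :
    (Pi.single (o.plus g) 1 + Pi.single (o.minus g) 1 : π.src.E → ℤ) =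
      π.p.pullE (Pi.single g.1 1) := by
  ext e'
  rw [HGraph.Harmonic.pullE_apply]
  by_cases h : π.p.onE e' = g.1
  · rw [h]
    rcases (o.onE_eq_iff g e').1 h with rfl | rfl
    · simp [o.degE_plus, (o.minus_ne_plus g).symm]
    · simp [o.degE_minus, o.minus_ne_plus g]
  · have h' : ¬ (e' = o.plus g ∨ e' = o.minus g) := fun h' => h ((o.onE_eq_iff g e').2 h')
    rw [not_or] at h'
    simp [h, h'.1, h'.2]

/-- Chains that push forward to zero are determined by their values on the edges `ẽ⁺`. -/
theorem chain_ext {c c' : π.src.E → ℤ} (hc : π.p.pushE c = 0) (hc' : π.p.pushE c' = 0)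
    (h : ∀ g, c (o.plus g) = c' (o.plus g)) : c = c' := by
  ext e'
  rcases o.edge_cases e' with hd | ⟨g, -, rfl | rfl⟩
  · rw [π.apply_eq_zero_of_push_eq_zero hc hd, π.apply_eq_zero_of_push_eq_zero hc' hd]
  · exact h g
  · have h1 := congrFun hc g.1
    have h2 := congrFun hc' g.1
    rw [o.pushE_apply, Pi.zero_apply] at h1 h2
    have := h g
    linarith

/-- The boundary on the source of an oriented double cover. -/
abbrev bd : (π.src.E → ℤ) →ₗ[ℤ] (π.src.V → ℤ) :=
  π.src.boundary (o.orientation.comap π.p.toHom)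

/-- The chain `∑ x(e) ẽ⁺`. -/
def plusChain (x : π.Eud → ℤ) : π.src.E → ℤ := ∑ g, x g • Pi.single (o.plus g) 1

theorem plusChain_plus (x : π.Eud → ℤ) (g : π.Eud) : o.plusChain x (o.plus g) = x g := by
  simp [plusChain, Finset.sum_apply, Pi.single_apply, o.plus_injective.eq_iff]

theorem plusChain_minus (x : π.Eud → ℤ) (g : π.Eud) : o.plusChain x (o.minus g) = 0 := by
  simp [plusChain, Finset.sum_apply, o.minus_ne_plus']

/-- The boundary of `ẽ⁺ - ẽ⁻`, as an anti-invariant divisor. -/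
def vec (g : π.Eud) : LinearMap.range π.antiV :=
  π.antiV.rangeRestrict (o.bd (Pi.single (o.plus g) 1))

/-- Since `antiE` maps ẽ⁺ to ẽ⁺ - ẽ⁻ and commutes with boundaries, a relation between the `vec g` is
the same as a cycle ∑ x(g)(g̃⁺ - g̃⁻). -/
theorem sum_smul_vec (x : π.Eud → ℤ) :
    ((∑ g, x g • o.vec g : LinearMap.range π.antiV) : π.src.V → ℤ) =
      o.bd (π.antiE (o.plusChain x)) := by
  rw [boundary_antiE, plusChain, map_sum, map_sum]
  simp only [map_smul, Submodule.coe_sum, Submodule.coe_smul]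
  rfl

theorem mem_rel_vec {x : π.Eud → ℤ} :
    x ∈ rel o.vec ↔ o.bd (π.antiE (o.plusChain x)) = 0 := by
  rw [mem_rel, ← Subtype.val_injective.eq_iff, sum_smul_vec]
  rfl

theorem antiE_plusChain {c : π.src.E → ℤ} (hc : π.p.pushE c = 0) :
    π.antiE (o.plusChain fun g => c (o.plus g)) = c :=
  o.chain_ext (π.pushE_antiE _) hc fun g => by
    rw [o.antiE_plus, o.plusChain_plus, o.plusChain_minus, sub_zero]

theorem antiE_plusChain_plus (x : π.Eud → ℤ) (g : π.Eud) :
    π.antiE (o.plusChain x) (o.plus g) = x g := by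
  rw [o.antiE_plus, o.plusChain_plus, o.plusChain_minus, sub_zero]

theorem coeff_mem_rel {c : π.src.E → ℤ} (hc : π.p.pushE c = 0) (hb : o.bd c = 0) :
    (fun g => c (o.plus g)) ∈ rel o.vec := by
  rw [mem_rel_vec, o.antiE_plusChain hc, hb]

theorem push_eq_zero (γ : o.kernel) : π.p.pushE γ.1.1 = 0 :=
  congrArg Subtype.val (LinearMap.mem_ker.1 γ.2)

theorem bd_eq_zero (γ : o.kernel) : o.bd γ.1.1 = 0 := HGraph.mem_H1_iff_boundary.1 γ.1.2

/-- The kernel of `p_*` is the group of relations between the vectors `o.vec`. -/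
def kernelEquiv : o.kernel ≃ₗ[ℤ] rel o.vec where
  toFun γ := ⟨o.coeff γ, o.coeff_mem_rel (o.push_eq_zero γ) (o.bd_eq_zero γ)⟩
  map_add' _ _ := rfl
  map_smul' _ _ := rfl
  invFun x := ⟨⟨π.antiE (o.plusChain x.1), HGraph.mem_H1_iff_boundary.2 (o.mem_rel_vec.1 x.2)⟩,
    LinearMap.mem_ker.2 (Subtype.ext (π.pushE_antiE _))⟩
  left_inv γ := Subtype.ext (Subtype.ext (o.antiE_plusChain (o.push_eq_zero γ)))
  right_inv x := Subtype.ext (funext fun g => o.antiE_plusChain_plus x.1 g)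

end Oriented

end DoubleCover

namespace DoubleCover

open LatticeRelation

variable {π : DoubleCover.{u}}

namespace Oriented

variable (o : π.Oriented)

/-! ### The index of the boundary lattice -/

/-- The divisors generated by pull-backs and by boundaries of edges not above `F`. -/
def divisors (F : Set π.Eud) : Submodule ℤ (π.src.V → ℤ) :=
  LinearMap.range π.p.pullV ⊔
    spanCompl (fun e' => o.bd (Pi.single e' 1)) (π.liftedEdges F)

theorem liftedEdges_mono {F F' : Set π.Eud} (h : F ⊆ F') :
    π.liftedEdges F ⊆ π.liftedEdges F' :=
  Set.preimage_mono (Set.image_mono h)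

theorem divisors_anti {F F' : Set π.Eud} (h : F ⊆ F') : o.divisors F' ≤ o.divisors F :=
  sup_le_sup_left (spanCompl_anti _ (liftedEdges_mono h)) _

theorem mem_divisors {F : Set π.Eud} {x : π.src.V → ℤ} : x ∈ o.divisors F ↔
    ∃ k c, (∀ e' ∈ π.liftedEdges F, c e' = 0) ∧ π.p.pullV k + o.bd c = x := by
  have hsum : ∀ c : π.src.E → ℤ, ∑ e', c e' • o.bd (Pi.single e' 1) = o.bd c := by
    intro c
    conv_rhs => rw [HGraph.chain_eq_sum c]
    simp only [map_sum, map_smul]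
  rw [divisors, Submodule.mem_sup]
  constructor
  · rintro ⟨_, ⟨k, rfl⟩, z, hz, rfl⟩
    obtain ⟨c, hc, rfl⟩ := (mem_spanCompl _).1 hz
    exact ⟨k, c, hc, by rw [hsum]⟩
  · rintro ⟨k, c, hc, rfl⟩
    exact ⟨_, ⟨k, rfl⟩, _, (mem_spanCompl _).2 ⟨c, hc, rfl⟩, by rw [hsum]⟩

theorem single_sub_single_mem {F : Set π.Eud} {h : π.src.H}
    (hF : π.src.edge h ∉ π.liftedEdges F) :
    (Pi.single (π.src.root h) 1 - Pi.single (π.src.root (π.src.inv h)) 1 : π.src.V → ℤ) ∈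
      o.divisors F := by
  have h1 : o.bd (Pi.single (π.src.edge h) 1) ∈ o.divisors F :=
    Submodule.mem_sup_right (mem_spanCompl_of_notMem (fun e' => o.bd (Pi.single e' 1)) hF)
  rw [HGraph.boundary_single] at h1
  rcases Int.units_eq_one_or ((o.orientation.comap π.p.toHom).sign h) with hs | hs
  · simpa [hs] using h1
  · rw [hs] at h1
    simpa using neg_mem h1

variable (π) in
/-- The component of `G \ F` below a vertex of the source. -/
def component (F : Set π.Eud) (v' : π.src.V) : (π.tgt.delete (π.edges F)).ConnectedComponent :=
  (π.tgt.delete (π.edges F)).connectedComponentMk (π.p.onV v')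

variable (π) in
/-- The degree modulo two of a divisor on the components of `G \ F`. -/
def parity (F : Set π.Eud) : (π.src.V → ℤ) →ₗ[ℤ]
    ((π.tgt.delete (π.edges F)).ConnectedComponent → ZMod 2) :=
  Fintype.linearCombination ℤ fun v' => Pi.single (component π F v') 1

theorem parity_single (F : Set π.Eud) (v' : π.src.V) :
    parity π F (Pi.single v' 1) = Pi.single (component π F v') 1 := by
  rw [parity, Fintype.linearCombination_apply_single, one_smul]

theorem parity_apply (F : Set π.Eud) (x : π.src.V → ℤ)
    (κ : (π.tgt.delete (π.edges F)).ConnectedComponent) :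
    parity π F x κ = ((∑ v' : π.src.V with component π F v' = κ, x v' : ℤ) : ZMod 2) := by
  rw [parity, Fintype.linearCombination_apply, Finset.sum_apply, Finset.sum_filter, Int.cast_sum]
  refine Finset.sum_congr rfl fun v' _ => ?_
  simp [Pi.single_apply, eq_comm (a := κ)]

theorem component_surjective (F : Set π.Eud) : Function.Surjective (component π F) := by
  intro κ
  induction κ using SimpleGraph.ConnectedComponent.ind with
  | _ v =>
    obtain ⟨v', rfl⟩ := π.onV_surjective v
    exact ⟨v', rfl⟩

theorem parity_surjective (F : Set π.Eud) : Function.Surjective (parity π F) := by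
  intro y
  choose s hs using component_surjective (π := π) F
  have : Fintype (π.tgt.delete (π.edges F)).ConnectedComponent := Fintype.ofFinite _
  refine ⟨∑ κ, ((y κ).val : ℤ) • Pi.single (s κ) 1, ?_⟩
  rw [map_sum]
  simp only [map_smul, parity_single, hs]
  ext κ
  simp only [Finset.sum_apply, Pi.smul_apply, Pi.single_apply, smul_ite, smul_zero,
    Finset.sum_ite_eq, Finset.mem_univ, if_true]
  simp

/-- The pull-back of a vertex has degree two on its component, and an edge not above F has both ends
over one component of G \ F. -/
theorem divisors_le_ker_parity (F : Set π.Eud) : o.divisors F ≤ LinearMap.ker (parity π F) := by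
  refine sup_le ?_ (Submodule.span_le.2 ?_)
  · rintro _ ⟨k, rfl⟩
    rw [HGraph.chain_eq_sum k]
    simp only [map_sum, map_smul]
    refine Submodule.sum_mem _ fun v _ => Submodule.smul_mem _ _ ?_
    rw [LinearMap.mem_ker]
    ext κ
    rw [parity_apply, Finset.sum_filter]
    have h1 : ∀ v', (if component π F v' = κ then π.p.pullV (Pi.single v 1) v' else 0) =
        if π.p.onV v' = v then (if (π.tgt.delete (π.edges F)).connectedComponentMk v = κ
          then (π.p.degV v' : ℤ) else 0) else 0 := by
      intro v'
      rw [HGraph.Harmonic.pullV_apply]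
      by_cases hv : π.p.onV v' = v
      · subst hv
        simp [component]
      · simp [hv]
    rw [Finset.sum_congr rfl fun v' _ => h1 v', ← Finset.sum_filter]
    split_ifs
    · rw [← Nat.cast_sum, π.degree_two]
      rfl
    · simp
  · rintro _ ⟨e', he', rfl⟩
    obtain ⟨h, rfl⟩ := π.src.edge_surjective e'
    have hh : π.tgt.edge (π.p.onH h) ∉ π.edges F := he'
    have h1 := SimpleGraph.ConnectedComponent.sound (π.tgt.delete_reachable hh)
    rw [π.p.inv_onH, π.p.root_onH, π.p.root_onH] at h1
    simp only [SetLike.mem_coe, LinearMap.mem_ker]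
    rw [HGraph.boundary_single, map_smul, map_sub, parity_single, parity_single, component,
      component, h1, sub_self, smul_zero]

/-- Relative connectedness makes all vertices over a component of G \ F equal in the quotient, and
their common class has order dividing two. A divisor of even degree over every component is
therefore zero there. -/
theorem ker_parity_le_divisors {F : Set π.Eud} (hF : π.RelConnected F) :
    LinearMap.ker (parity π F) ≤ o.divisors F := by
  intro x hx
  let q : π.src.V → (π.src.V → ℤ) ⧸ o.divisors F := fun v' =>
    (o.divisors F).mkQ (Pi.single v' 1)
  have hq : ∀ v' w', component π F v' = component π F w' → q v' = q w' := by
    intro v' w' h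
    refine π.src.eq_of_reachable q (fun h hh => ?_)
      (hF v' w' (SimpleGraph.ConnectedComponent.exact h))
    rw [← sub_eq_zero, ← map_sub, Submodule.mkQ_apply, Submodule.Quotient.mk_eq_zero]
    exact o.single_sub_single_mem hh
  -- The pull-back of a vertex is zero in the quotient and is a combination of equal classes with
  -- total weight two.
  have hq2 : ∀ v', (2 : ℤ) • q v' = 0 := by
    intro v'
    have h1 : π.p.pullV (Pi.single (π.p.onV v') 1) =
        ∑ w' : π.src.V with π.p.onV w' = π.p.onV v', (π.p.degV w' : ℤ) •
          (Pi.single w' 1 : π.src.V → ℤ) := by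
      ext u'
      rw [HGraph.Harmonic.pullV_apply, Finset.sum_apply, Finset.sum_filter,
        Finset.sum_eq_single u']
      · simp [Pi.single_apply]
      · intro b _ hb
        simp [hb]
      · simp
    have h2 : (o.divisors F).mkQ (π.p.pullV (Pi.single (π.p.onV v') 1)) = 0 := by
      rw [Submodule.mkQ_apply, Submodule.Quotient.mk_eq_zero]
      exact Submodule.mem_sup_left ⟨_, rfl⟩
    rw [h1, map_sum] at h2
    have h3 : ∀ w' ∈ Finset.univ.filter (fun w' => π.p.onV w' = π.p.onV v'),
        (o.divisors F).mkQ ((π.p.degV w' : ℤ) • (Pi.single w' 1 : π.src.V → ℤ)) =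
          (π.p.degV w' : ℤ) • q v' := by
      intro w' hw'
      rw [map_smul, ← hq w' v' (by rw [component, component, (Finset.mem_filter.1 hw').2])]
    rw [Finset.sum_congr rfl h3, ← Finset.sum_smul, ← Nat.cast_sum, π.degree_two] at h2
    exact h2
  rw [← Submodule.Quotient.mk_eq_zero, ← Submodule.mkQ_apply]
  choose s hs using component_surjective (π := π) F
  have : Fintype (π.tgt.delete (π.edges F)).ConnectedComponent := Fintype.ofFinite _
  rw [HGraph.chain_eq_sum x, map_sum, ← Finset.sum_fiberwise (g := component π F)]
  refine Finset.sum_eq_zero fun κ _ => ?_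
  have h1 : ∀ v' ∈ Finset.univ.filter (fun v' => component π F v' = κ),
      (o.divisors F).mkQ (x v' • (Pi.single v' 1 : π.src.V → ℤ)) = x v' • q (s κ) := by
    intro v' hv'
    rw [map_smul, ← hq v' (s κ) (by rw [hs, (Finset.mem_filter.1 hv').2])]
  rw [Finset.sum_congr rfl h1, ← Finset.sum_smul]
  have h2 := congrFun (LinearMap.mem_ker.1 hx) κ
  rw [parity_apply, Pi.zero_apply, ZMod.intCast_zmod_eq_zero_iff_dvd] at h2
  obtain ⟨n, hn⟩ := h2
  rw [hn, mul_comm, mul_smul, Nat.cast_ofNat, hq2, smul_zero]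

theorem index_divisors {F : Set π.Eud} (hF : π.RelConnected F) :
    (o.divisors F).toAddSubgroup.index = 2 ^ π.index F := by
  have h1 : o.divisors F = LinearMap.ker (parity π F) :=
    le_antisymm (o.divisors_le_ker_parity F) (o.ker_parity_le_divisors hF)
  have h2 : (o.divisors F).toAddSubgroup = (parity π F).toAddMonoidHom.ker := by
    rw [h1]
    rfl
  have : Fintype (π.tgt.delete (π.edges F)).ConnectedComponent := Fintype.ofFinite _
  rw [h2, AddSubgroup.index_ker, AddMonoidHom.range_eq_top.2 (parity_surjective F),
    AddSubgroup.card_top, Nat.card_fun, Nat.card_zmod, index]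

/-! ### The vectors `o.vec` represent the signed graphic matroid -/

/-- Under `antiE` the edges ẽ⁺ and ẽ⁻ become opposite and edges over dilated ones vanish, so the
edges ẽ⁺ alone suffice as generators. -/
theorem bd_single_mem {F : Set π.Eud} {e' : π.src.E} (he' : e' ∉ π.liftedEdges F) :
    π.antiV (o.bd (Pi.single e' 1)) ∈
      Submodule.span ℤ ((fun g => π.antiV (o.bd (Pi.single (o.plus g) 1))) '' Fᶜ) := by
  rw [← boundary_antiE]
  rcases o.edge_cases e' with hd | ⟨g, hg, he⟩
  · have h1 : (2 : ℤ) • π.antiE (Pi.single e' 1) = 0 := by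
      rw [← map_smul, π.two_smul_single hd, antiE_pullE]
    rw [(smul_eq_zero.1 h1).resolve_left two_ne_zero, map_zero]
    exact zero_mem _
  · have hgF : g ∉ F := fun h => he' ⟨g, h, hg.symm⟩
    have h1 : π.antiV (o.bd (Pi.single (o.plus g) 1)) ∈
      Submodule.span ℤ ((fun g => π.antiV (o.bd (Pi.single (o.plus g) 1))) '' Fᶜ) :=
      Submodule.subset_span ⟨g, hgF, rfl⟩
    rw [← boundary_antiE] at h1
    rcases he with rfl | rfl
    · exact h1
    · have h2 := congrArg π.antiE (o.single_plus_add_single_minus g)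
      rw [antiE_pullE, map_add] at h2
      rw [eq_neg_of_add_eq_zero_right h2, map_neg]
      exact neg_mem h1

theorem comap_spanCompl_vec (F : Set π.Eud) :
    (spanCompl o.vec F).comap π.antiV.rangeRestrict = o.divisors F ⊔ LinearMap.ker π.antiV := by
  have h1 : spanCompl o.vec F = (Submodule.span ℤ
      ((fun g => o.bd (Pi.single (o.plus g) 1)) '' Fᶜ)).map π.antiV.rangeRestrict := by
    rw [Submodule.map_span, Set.image_image]
    rfl
  refine le_antisymm ?_ (sup_le ?_ ?_)
  · rw [h1, Submodule.comap_map_eq, LinearMap.ker_rangeRestrict]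
    refine sup_le_sup_right (Submodule.span_le.2 ?_) _
    rintro _ ⟨g, hg, rfl⟩
    refine Submodule.mem_sup_right
      (mem_spanCompl_of_notMem (fun e' => o.bd (Pi.single e' 1)) ?_)
    rintro ⟨g', hg', heq⟩
    rw [o.onE_plus] at heq
    exact hg (Subtype.ext heq ▸ hg')
  · refine sup_le ?_ (Submodule.span_le.2 ?_)
    · rintro _ ⟨k, rfl⟩
      have : π.antiV.rangeRestrict (π.p.pullV k) = 0 := Subtype.ext (π.antiV_pullV k)
      rw [Submodule.mem_comap, this]
      exact zero_mem _
    · rintro _ ⟨e', he', rfl⟩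
      have h2 := o.bd_single_mem he'
      have h3 : spanCompl o.vec F = (Submodule.span ℤ ((fun g =>
          π.antiV (o.bd (Pi.single (o.plus g) 1))) '' Fᶜ)).comap
            (LinearMap.range π.antiV).subtype := by
        have h4 : (fun g => π.antiV (o.bd (Pi.single (o.plus g) 1))) '' Fᶜ =
            (LinearMap.range π.antiV).subtype '' (o.vec '' Fᶜ) := by
          rw [Set.image_image]
          rfl
        rw [h4, ← Submodule.map_span, Submodule.comap_map_eq_of_injective
          (Submodule.injective_subtype _)]
        rfl
      rw [h3]
      exact h2
  · intro x hx
    have : π.antiV.rangeRestrict x = 0 := Subtype.ext hx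
    rw [Submodule.mem_comap, this]
    exact zero_mem _

/-- By `comap_spanCompl_vec` the left index is that of D + K, where D = `divisors F` and K = ker
`antiV`. Then [D + K : D] = [K : D ∩ K]. -/
theorem index_spanCompl_vec (F : Set π.Eud) :
    (spanCompl o.vec F).toAddSubgroup.index *
        (o.divisors F).toAddSubgroup.relIndex (LinearMap.ker π.antiV).toAddSubgroup =
      (o.divisors F).toAddSubgroup.index := by
  have h1 : (spanCompl o.vec F).toAddSubgroup.index =
      (o.divisors F ⊔ LinearMap.ker π.antiV).toAddSubgroup.index := by
    rw [← o.comap_spanCompl_vec]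
    exact (AddSubgroup.index_comap_of_surjective (f := π.antiV.rangeRestrict.toAddMonoidHom) _
      π.antiV.surjective_rangeRestrict).symm
  rw [h1, ← AddSubgroup.relIndex_mul_index (show (o.divisors F).toAddSubgroup ≤
    (o.divisors F ⊔ LinearMap.ker π.antiV).toAddSubgroup from
      (le_sup_left : o.divisors F ≤ o.divisors F ⊔ LinearMap.ker π.antiV)), mul_comm]
  congr 1
  rw [Submodule.sup_toAddSubgroup, AddSubgroup.relIndex_sup_left]

/-- By `relConnected_iff`, it is enough to kill an odd function f that is constant along edges not
above F. As a functional on divisors, f vanishes on the lattice spanned outside F, hence on all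
anti-invariant divisors, because a multiple of each lies in that lattice. -/
theorem relConnected_of_spanCompl {F : Set π.Eud}
    (h : ∀ y : LinearMap.range π.antiV, ∃ n : ℤ, n ≠ 0 ∧ n • y ∈ spanCompl o.vec F) :
    π.RelConnected F := by
  rw [relConnected_iff]
  intro f hf hloc
  let ev : (π.src.V → ℤ) →ₗ[ℤ] ℚ := Fintype.linearCombination ℤ f
  have hev : ∀ v', ev (Pi.single v' 1) = f v' := fun v' => by
    simp only [ev]
    rw [Fintype.linearCombination_apply_single, one_smul]
  have hpull : ∀ k, ev (π.p.pullV k) = 0 := by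
    intro k
    simp only [ev]
    rw [Fintype.linearCombination_apply, ← Finset.sum_fiberwise (g := π.p.onV)]
    refine Finset.sum_eq_zero fun v _ => ?_
    have h1 := hf v
    rw [← mul_zero (k v : ℚ), ← h1, Finset.mul_sum]
    refine Finset.sum_congr rfl fun v' hv' => ?_
    rw [HGraph.Harmonic.pullV_apply, (Finset.mem_filter.1 hv').2]
    simp
    ring
  -- An odd function kills pull-backs, so only the term 2x of `antiV x` remains.
  have hanti : ∀ x, ev (π.antiV x) = 2 * ev x := by
    intro x
    rw [antiV_apply, map_sub, hpull, map_smul]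
    simp
  have hspan : spanCompl o.vec F ≤
      LinearMap.ker (ev ∘ₗ (LinearMap.range π.antiV).subtype) := by
    refine Submodule.span_le.2 ?_
    rintro _ ⟨g, hg, rfl⟩
    simp only [SetLike.mem_coe, LinearMap.mem_ker]
    change ev (π.antiV (o.bd (Pi.single (o.plus g) 1))) = 0
    obtain ⟨h', hh'⟩ := π.src.edge_surjective (o.plus g)
    rw [hanti, ← hh', HGraph.boundary_single, map_smul, map_sub, hev, hev, hloc h', sub_self,
      smul_zero, mul_zero]
    rintro ⟨g', hg', heq⟩
    rw [hh', o.onE_plus] at heq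
    exact hg (Subtype.ext heq ▸ hg')
  ext v'
  obtain ⟨n, hn, hmem⟩ := h (π.antiV.rangeRestrict (Pi.single v' 1))
  have h1 := hspan hmem
  rw [LinearMap.mem_ker, map_smul] at h1
  have h2 : ev (π.antiV (Pi.single v' 1)) = 0 := (smul_eq_zero.1 h1).resolve_left hn
  rw [hanti, hev] at h2
  simpa using h2

/-- If F is independent, the index of the span times some factor is 2^{ind(F)} ≠ 0, so the span has
finite index. -/
theorem represents_cographicMatroid : Represents π.cographicMatroid o.vec where
  ground := rfl
  indep_iff F := by
    rw [cographicMatroid_indep]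
    refine ⟨fun hF y => ?_, o.relConnected_of_spanCompl⟩
    have h1 := o.index_spanCompl_vec F
    rw [o.index_divisors hF] at h1
    have h2 : (spanCompl o.vec F).toAddSubgroup.index ≠ 0 := by
      intro h0
      rw [h0, zero_mul] at h1
      exact (pow_pos two_pos _).ne h1
    obtain ⟨n, hn, -, hy⟩ := AddSubgroup.exists_nsmul_mem_of_index_ne_zero h2 y
    refine ⟨n, by exact_mod_cast hn.ne', ?_⟩
    rw [natCast_zsmul]
    exact hy

/-- If pullV k + ∂c lies in ker `antiV`, then `antiE c` is an anti-invariant cycle that vanishes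
above B, hence is zero. So c agrees on ẽ⁺ and ẽ⁻ and is, on undilated edges, a pull-back that can be
absorbed into k. The resulting description no longer involves B. -/
theorem divisors_inf_ker {B : Set π.Eud} (hB : π.cographicMatroid.IsBase B) :
    o.divisors B ⊓ LinearMap.ker π.antiV = o.divisors Set.univ ⊓ LinearMap.ker π.antiV := by
  refine le_antisymm (le_inf ?_ inf_le_right)
    (inf_le_inf_right _ (o.divisors_anti (Set.subset_univ B)))
  rintro x ⟨hx, hxk⟩
  obtain ⟨k, c, hc, rfl⟩ := o.mem_divisors.1 hx
  have h1 : o.bd (π.antiE c) = 0 := by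
    rw [boundary_antiE]
    simpa [antiV_pullV] using hxk
  have h2 := o.represents_cographicMatroid.eq_zero hB
    (o.coeff_mem_rel (π.pushE_antiE c) h1) fun g hg => by
      rw [o.antiE_plus, hc, hc, sub_zero]
      · exact ⟨g, hg, (o.onE_minus g).symm⟩
      · exact ⟨g, hg, (o.onE_plus g).symm⟩
  have h3 : ∀ g, c (o.plus g) = c (o.minus g) := fun g => by
    have := congrFun h2 g
    simp only [o.antiE_plus, Pi.zero_apply] at this
    linarith
  -- The value on dilated edges is arbitrary: membership in `divisors Set.univ` allows any
  -- coefficients above them.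
  let b : π.tgt.E → ℤ := fun e => if h : π.IsDilated e then 0 else c (o.plus ⟨e, h⟩)
  refine o.mem_divisors.2 ⟨k + π.tgt.boundary o.orientation b, c - π.p.pullE b, ?_, ?_⟩
  · rintro e' ⟨g, -, hg⟩
    rw [Pi.sub_apply, HGraph.Harmonic.pullE_apply, ← hg]
    have hb : b g.1 = c (o.plus g) := by simp only [b]; rw [dif_neg g.2]
    rw [hb]
    rcases (o.onE_eq_iff g e').1 hg.symm with rfl | rfl
    · simp [o.degE_plus]
    · simp [o.degE_minus, h3]
  · rw [map_add, map_sub, HGraph.Harmonic.boundary_pullE]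
    abel

/-- The common factor κ is the index of `divisors Set.univ` ∩ ker `antiV` in ker `antiV`, the same
for every base by `divisors_inf_ker`. -/
theorem hasIndex_cographicMatroid : HasIndex π.cographicMatroid o.vec π.index := by
  refine ⟨(o.divisors Set.univ).toAddSubgroup.relIndex (LinearMap.ker π.antiV).toAddSubgroup,
    fun B hB => ?_⟩
  rw [← o.index_divisors hB.indep, ← o.index_spanCompl_vec B]
  congr 1
  rw [← AddSubgroup.inf_relIndex_right,
    ← AddSubgroup.inf_relIndex_right (o.divisors B).toAddSubgroup]
  congr 1
  exact congrArg Submodule.toAddSubgroup (o.divisors_inf_ker hB).symm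

end Oriented

end DoubleCover

/-! ### Isomorphisms of principalized Prym varieties -/

/-- An isomorphism of lattices that preserves the polarization forms is an isomorphism of
pptavs. -/
def PPTAV.Iso.ofPush {P : PPTAV.{u}} {Q : PPTAV.{v}} (f : P.torus.L' ≃ₗ[ℤ] Q.torus.L')
    (hf : ∀ a b, P.torus.pairing (P.polarization.map a) b =
      Q.torus.pairing (Q.polarization.map (f a)) (f b)) : PPTAV.Iso P Q where
  -- Compatibility with the polarizations forces f^# = ξ_P ∘ f⁻¹ ∘ ξ_Q⁻¹.
  pull := (LinearEquiv.ofBijective Q.polarization.map Q.principal).symm.trans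
    (f.symm.trans (LinearEquiv.ofBijective P.polarization.map P.principal))
  push := f
  adjoint l l' := by
    obtain ⟨x, rfl⟩ := (LinearEquiv.ofBijective Q.polarization.map Q.principal).surjective l
    rw [LinearEquiv.trans_apply, LinearEquiv.symm_apply_apply, LinearEquiv.trans_apply]
    have h := hf (f.symm x) l'
    rwa [LinearEquiv.apply_symm_apply] at h
  polarization l' := by
    have h : Q.polarization.map (f l') =
        LinearEquiv.ofBijective Q.polarization.map Q.principal (f l') := rfl
    rw [h, LinearEquiv.trans_apply, LinearEquiv.symm_apply_apply, LinearEquiv.trans_apply,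
      LinearEquiv.symm_apply_apply]
    rfl

namespace DoubleCover.Oriented

open LatticeRelation

variable {π : DoubleCover.{u}} (o : π.Oriented)

theorem isFundamentalCycle_iff {C : Set π.Eud} {γ : o.kernel} :
    o.IsFundamentalCycle C γ ↔ IsFundamental o.vec C (o.coeff γ) := by
  let ι : o.kernel →ₗ[ℤ] (π.Eud → ℤ) := (rel o.vec).subtype ∘ₗ o.kernelEquiv.toLinearMap
  have hι : Function.Injective ι := Subtype.val_injective.comp o.kernelEquiv.injective
  have hmap : (o.kernelOn C).map ι = relOn o.vec C := by
    ext x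
    constructor
    · rintro ⟨γ, hγ, rfl⟩
      refine ⟨(o.kernelEquiv γ).2, fun g hg => hγ _ ?_⟩
      rintro ⟨g', hg', heq⟩
      rw [o.onE_plus] at heq
      exact hg (Subtype.ext heq ▸ hg')
    · rintro ⟨hx, hxC⟩
      obtain ⟨γ, hγ⟩ := o.kernelEquiv.surjective ⟨x, hx⟩
      have hγ' : o.coeff γ = x := congrArg Subtype.val hγ
      refine ⟨γ, fun e' he' => ?_, hγ'⟩
      have hpush := o.push_eq_zero γ
      rcases o.edge_cases e' with hd | ⟨g, hg, he⟩
      · exact π.apply_eq_zero_of_push_eq_zero hpush hd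
      · have h1 : γ.1.1 (o.plus g) = 0 := by
          have := hxC g fun h => he' ⟨g, h, hg.symm⟩
          rwa [← hγ'] at this
        rcases he with rfl | rfl
        · exact h1
        · have h2 := congrFun hpush g.1
          rwa [o.pushE_apply, h1, zero_add] at h2
  rw [IsFundamentalCycle, IsFundamental, ← hmap,
    ← (Submodule.map_injective_of_injective hι).eq_iff, Submodule.map_span, Set.image_singleton]
  rfl

/-- Circuits of M are by definition cocircuits of M^*, so oriented circuits can be read off from
fundamental relations. -/
theorem mem_orientedCircuits {s : π.Eud → SignType} : s ∈ o.orientedCircuits ↔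
    ∃ C c, π.cographicMatroid.IsCocircuit C ∧ IsFundamental o.vec C c ∧
      s = fun e => SignType.sign (c e) := by
  constructor
  · rintro ⟨C, hC, γ, hγ, rfl⟩
    exact ⟨C, o.coeff γ, hC, o.isFundamentalCycle_iff.1 hγ, rfl⟩
  · rintro ⟨C, c, hC, hc, rfl⟩
    obtain ⟨γ, hγ⟩ := o.kernelEquiv.surjective ⟨c, hc.mem.1⟩
    obtain rfl : o.coeff γ = c := congrArg Subtype.val hγ
    exact ⟨C, hC, γ, o.isFundamentalCycle_iff.2 hc, rfl⟩

end DoubleCover.Oriented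

/-! ### The polarization form in coordinates. -/

namespace MetricDoubleCover

open LatticeRelation

/-- Elements of the kernel vanish over dilated edges. Over an undilated edge e the two lifts have
length ℓ(e) and opposite coefficients, which gives the factor 2. -/
theorem sum_coeff (π : MetricDoubleCover.{u}) (o : π.Oriented) (γ δ : o.kernel) :
    ∑ e', (γ.1.1 e' : ℝ) * (δ.1.1 e' : ℝ) * π.srcLen e' =
      2 * ∑ g, (o.coeff γ g : ℝ) * (o.coeff δ g : ℝ) * π.len g := by
  have hlen : ∀ e', π.p.degE e' = 1 → π.srcLen e' = π.tgtLen (π.p.onE e') := by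
    intro e' h
    rw [π.dilation, h, Nat.cast_one, one_mul]
  have hminus : ∀ (γ : o.kernel) g, γ.1.1 (o.minus g) = -o.coeff γ g := by
    intro γ g
    have := congrFun (o.push_eq_zero γ) g.1
    rw [o.pushE_apply] at this
    exact eq_neg_of_add_eq_zero_right this
  rw [← Finset.sum_fiberwise (g := π.p.onE), Finset.mul_sum]
  symm
  refine Finset.sum_of_injOn Subtype.val Subtype.val_injective.injOn (fun _ _ => Finset.mem_univ _)
    ?_ ?_
  · intro e _ he
    refine Finset.sum_eq_zero fun e' he' => ?_
    have hd : π.IsDilated (π.p.onE e') := by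
      by_contra h
      rw [(Finset.mem_filter.1 he').2] at h
      exact he ⟨⟨e, h⟩, by simp, rfl⟩
    rw [π.apply_eq_zero_of_push_eq_zero (o.push_eq_zero γ) hd]
    simp
  · intro g _
    rw [o.filter_onE, Finset.sum_pair (o.minus_ne_plus g).symm, hminus, hminus,
      hlen _ (o.degE_plus g), hlen _ (o.degE_minus g), o.onE_plus, o.onE_minus]
    simp only [DoubleCover.Oriented.coeff, len]
    push_cast
    ring

/-- The polarization form of the principalized Prym variety in terms of coefficients. -/
theorem prymPrincipal_pairing (π : MetricDoubleCover.{u}) (o : π.Oriented) (γ δ : o.kernel) :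
    (π.prymPrincipal o).torus.pairing ((π.prymPrincipal o).polarization.map γ) δ =
      2 * ∑ g, (o.coeff γ g : ℝ) * (o.coeff δ g : ℝ) * π.len g :=
  π.sum_coeff o γ δ

end MetricDoubleCover

namespace LatticeRelation

/-- A signed permutation of coordinates that preserves relations in both directions. -/
def relEquiv {E₁ E₂ Y₁ Y₂ : Type*} [Fintype E₁] [Fintype E₂] [AddCommGroup Y₁] [AddCommGroup Y₂]
    {d₁ : E₁ → Y₁} {d₂ : E₂ → Y₂} (φ : E₁ ≃ E₂) (a : E₂ → ℤˣ)
    (h : ∀ x ∈ rel d₁, signedRelabel φ a x ∈ rel d₂)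
    (h' : ∀ x ∈ rel d₂, signedRelabel φ.symm (a ∘ φ) x ∈ rel d₁) : rel d₁ ≃ₗ[ℤ] rel d₂ where
  toFun x := ⟨signedRelabel φ a x.1, h _ x.2⟩
  map_add' x y := Subtype.ext (map_add _ _ _)
  map_smul' c x := Subtype.ext (map_smul _ _ _)
  invFun x := ⟨signedRelabel φ.symm (a ∘ φ) x.1, h' _ x.2⟩
  left_inv x := by
    ext e
    simp [signedRelabel_apply, ← mul_assoc, ← Units.val_mul, Int.units_mul_self]
  right_inv x := by
    ext e
    simp [signedRelabel_apply, ← mul_assoc, ← Units.val_mul, Int.units_mul_self]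

end LatticeRelation

end TropicalPrym

end

/-! ### Assembly of the isomorphism. -/

open TropicalPrym TropicalPrym.LatticeRelation in
theorem corollary3p15
    (π₁ π₂ : TropicalPrym.MetricDoubleCover)
    (o₁ : π₁.Oriented) (o₂ : π₂.Oriented)
    (φ : π₁.Eud ≃ π₂.Eud)
    (hlen : ∀ e, π₂.len (φ e) = π₁.len e)
    (hindep : ∀ F : Set π₁.Eud,
      π₁.cographicMatroid.Indep F ↔ π₂.cographicMatroid.Indep (φ '' F))
    (hindex : ∀ F : Set π₁.Eud, π₁.cographicMatroid.Indep F →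
      π₂.index (φ '' F) = π₁.index F)
    (hreorient : ∃ A : Set π₂.Eud,
      TropicalPrym.relabel φ o₁.orientedCircuits =
        TropicalPrym.reorient A o₂.orientedCircuits) :
    Nonempty (TropicalPrym.PPTAV.Iso (π₁.prymPrincipal o₁) (π₂.prymPrincipal o₂)) := by
  classical
  obtain ⟨A, hA⟩ := hreorient
  -- These signs undo the reorientation along A, so that the relabelled relations have the signs of
  -- the second cover.
  let a : π₂.Eud → ℤˣ := fun e => if e ∈ A then -1 else 1
  have himg : ∀ F : Set π₂.Eud, φ '' (φ.symm '' F) = F := fun F => by simp [Set.image_image]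
  have h₁₂ : ∀ x ∈ rel o₁.vec, signedRelabel φ a x ∈ rel o₂.vec := by
    intro x hx
    refine signedRelabel_mem_rel o₁.represents_cographicMatroid o₂.represents_cographicMatroid φ
      hindep o₁.hasIndex_cographicMatroid o₂.hasIndex_cographicMatroid hindex a ?_ hx
    intro C c hC hc
    have hmem : (fun e => SignType.sign (c e)) ∘ φ.symm ∈ relabel φ o₁.orientedCircuits :=
      ⟨_, o₁.mem_orientedCircuits.2 ⟨C, c, hC, hc, rfl⟩, rfl⟩
    rw [hA] at hmem
    obtain ⟨s, hs, heq⟩ := hmem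
    obtain ⟨C', c', hC', hc', rfl⟩ := o₂.mem_orientedCircuits.1 hs
    refine ⟨C', c', hC', hc', fun e => ?_⟩
    have h1 := congrFun heq e
    simp only [Function.comp_apply] at h1
    rw [signedRelabel_apply, sign_mul, ← h1]
    by_cases he : e ∈ A <;> simp [a, he]
  -- The hypotheses are symmetric in the two covers, and the inverse signed permutation uses the
  -- same signs because they square to 1.
  have h₂₁ : ∀ x ∈ rel o₂.vec, signedRelabel φ.symm (a ∘ φ) x ∈ rel o₁.vec := by
    intro x hx
    refine signedRelabel_mem_rel o₂.represents_cographicMatroid o₁.represents_cographicMatroid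
      φ.symm (fun F => by rw [hindep, himg]) o₂.hasIndex_cographicMatroid
      o₁.hasIndex_cographicMatroid (fun F hF => ?_) (a ∘ φ) ?_ hx
    · rw [← hindex, himg]
      rwa [hindep, himg]
    intro C c hC hc
    have hmem : (fun e => if e ∈ A then -SignType.sign (c e) else SignType.sign (c e)) ∈
        reorient A o₂.orientedCircuits :=
      ⟨_, o₂.mem_orientedCircuits.2 ⟨C, c, hC, hc, rfl⟩, rfl⟩
    rw [← hA] at hmem
    obtain ⟨s, hs, heq⟩ := hmem
    obtain ⟨C', c', hC', hc', rfl⟩ := o₁.mem_orientedCircuits.1 hs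
    refine ⟨C', c', hC', hc', fun e => ?_⟩
    have h1 := congrFun heq (φ e)
    simp only [Function.comp_apply, Equiv.symm_apply_apply] at h1
    rw [signedRelabel_apply, sign_mul, h1]
    by_cases he : φ e ∈ A <;> simp [a, he]
  let f : o₁.kernel ≃ₗ[ℤ] o₂.kernel :=
    o₁.kernelEquiv.trans ((relEquiv φ a h₁₂ h₂₁).trans o₂.kernelEquiv.symm)
  have hf : ∀ γ e, o₂.coeff (f γ) (φ e) = a (φ e) * o₁.coeff γ e := by
    intro γ e
    have h1 : o₂.kernelEquiv (f γ) = relEquiv φ a h₁₂ h₂₁ (o₁.kernelEquiv γ) := by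
      simp [f]
    have h2 : o₂.coeff (f γ) = signedRelabel φ a (o₁.coeff γ) := congrArg Subtype.val h1
    rw [h2, signedRelabel_apply, Equiv.symm_apply_apply]
  have hform : ∀ γ δ : o₁.kernel,
      2 * ∑ e, (o₁.coeff γ e : ℝ) * (o₁.coeff δ e : ℝ) * π₁.len e =
        2 * ∑ e, (o₂.coeff (f γ) e : ℝ) * (o₂.coeff (f δ) e : ℝ) * π₂.len e := by
    intro γ δ
    rw [← Equiv.sum_comp φ]
    congr 1
    refine Finset.sum_congr rfl fun e _ => ?_
    -- The form is diagonal in the coefficients, so each sign occurs squared and drops out.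
    have ha : ((a (φ e) : ℤ) : ℝ) * ((a (φ e) : ℤ) : ℝ) = 1 := by
      rw [← Int.cast_mul, ← Units.val_mul, Int.units_mul_self]
      simp
    rw [hf, hf, hlen]
    push_cast
    linear_combination (-(o₁.coeff γ e : ℝ) * (o₁.coeff δ e : ℝ) * π₁.len e) * ha
  exact ⟨PPTAV.Iso.ofPush f fun γ δ => (π₁.prymPrincipal_pairing o₁ γ δ).trans
    ((hform γ δ).trans (π₂.prymPrincipal_pairing o₂ (f γ) (f δ)).symm)⟩
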